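/- Let $\varepsilon\in\{-1,1\}$. A Lorentzian almost contact ($\varepsilon=-1$) or almost paracontact ($\varepsilon=1$) manifold $M(\phi,\xi,\eta,g_M)$ is a Lorentzian manifold $(M,g_M)$ of dimension $2m+1$ with a smooth $(1,1)$-tensor field $\phi$, a smooth vector field $\xi$ and a $1$-form $\eta$ such that $$\phi^2X=\varepsilon X+\eta(X)\xi,\quad g_M(\phi X,\phi Y)=g_M(X,Y)+\eta(X)\eta(Y),\quad \eta(X)=\varepsilon g_M(X,\xi),\quad \eta(\xi)=-\varepsilon .$$ It is called Lorentzian Sasakian ($\varepsilon=-1$), respectively Lorentzian para Sasakian ($\varepsilon=1$), if $$(\nabla_X\phi)Y=g_M(\phi X,\phi Y)\,\xi+\varepsilon\,\eta(Y)\,\phi^2X$$ for the Levi-Civita connection $\nabla$ of $g_M$ (for $\varepsilon=-1$ the right-hand side is $g_M(X,Y)\xi+\eta(Y)X$). A semi-Riemannian submersion $F:(M,g_M)\to(N,g_N)$ is a surjective smooth submersion whose fibres are semi-Riemannian submanifolds and whose differential $F_*$ preserves scalar products of vectors normal to the fibres. It is anti-invariant if $\phi(\ker F_*)\subseteq(\ker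 F_*)^\perp$. Let $\mathcal V$, $\mathcal H$ be the orthogonal projections onto $\ker F_*$ and $(\ker F_*)^\perp$, let $\mathcal T_XY=\mathcal H\nabla_{\mathcal VX}\mathcal VY+\mathcal V\nabla_{\mathcal VX}\mathcal HY$ be O'Neill's tensor, and call $F$ harmonic if its tension field $\sum_i\epsilon_i(\nabla F_*)(e_i,e_i)$ vanishes ($e_i$ an orthonormal frame of $M$, $\epsilon_i=g_M(e_i,e_i)$). **Theorem.** Let $F:M(\phi,\xi,\eta,g_M)\to(N,g_N)$ be an anti-invariant semi-Riemannian submersion from a Lorentzian Sasakian or Lorentzian para Sasakian manifold of dimension $2m+1$ onto a Riemannian manifold of dimension $n$, and suppose $m=n$. Then $F$ is harmonic if and only if $$\operatorname{tr}\bigl(\phi\,\mathcal T_V\bigr)=-n\,\eta(V)\qquad\text{for every vertical vector } V\in\ker F_*,$$ where the trace is that of $\phi\,\mathcal T_V$ on $\ker F_*$, that is, $\operatorname{tr}(\phi\,\mathcal T_V)=\sum_i\epsilon_i\,g_M(\phi\,\mathcal T_Ve_i,e_i)$ for an orthonormal basis $e_i$ of $\ker F_*$ with $\epsilon_i=g_M(e_i,e_i)$.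 -/

import Mathlib

open Bundle Module
open scoped Manifold ContDiff

namespace SemiRiem

noncomputable section

section Coordinates

variable {E M : Type*} [NormedAddCommGroup E] [NormedSpace ℝ E]
  [TopologicalSpace M] [ChartedSpace E M] [IsManifold 𝓘(ℝ, E) ∞ M]

/-- Components of a tangent vector at `q` with respect to the preferred chart at `p`
(meaningful for `q` in the domain of that chart). -/
def coordAt (p q : M) : TangentSpace 𝓘(ℝ, E) q →L[ℝ] E :=
  (trivializationAt E (TangentSpace 𝓘(ℝ, E)) p).continuousLinearMapAt ℝ q

/-- The tangent vector at `q` with given components in the preferred chart at `p`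
(meaningful for `q` in the domain of that chart). -/
def coordSymm (p q : M) : E →L[ℝ] TangentSpace 𝓘(ℝ, E) q :=
  (trivializationAt E (TangentSpace 𝓘(ℝ, E)) p).symmL ℝ q

/-- The vector field `Y` is smooth near the point `p`. -/
def SmoothFieldAt (Y : Π q : M, TangentSpace 𝓘(ℝ, E) q) (p : M) : Prop :=
  ContMDiffAt 𝓘(ℝ, E) (𝓘(ℝ, E).prod 𝓘(ℝ, E)) ∞
    (fun q ↦ (TotalSpace.mk' E q (Y q) : TangentBundle 𝓘(ℝ, E) M)) p

end Coordinates

/-- A smooth semi-Riemannian metric: a smooth field of nondegenerate symmetric bilinear forms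
on the tangent spaces. -/
structure Metric (E M : Type*) [NormedAddCommGroup E] [NormedSpace ℝ E]
    [TopologicalSpace M] [ChartedSpace E M] [IsManifold 𝓘(ℝ, E) ∞ M] where
  inner (p : M) : TangentSpace 𝓘(ℝ, E) p →L[ℝ] TangentSpace 𝓘(ℝ, E) p →L[ℝ] ℝ
  symm (p : M) (v w : TangentSpace 𝓘(ℝ, E) p) : inner p v w = inner p w v
  nondegenerate (p : M) (v : TangentSpace 𝓘(ℝ, E) p) (hv : ∀ w, inner p v w = 0) : v = 0
  contMDiff : ContMDiff 𝓘(ℝ, E) (𝓘(ℝ, E).prod 𝓘(ℝ, E →L[ℝ] E →L[ℝ] ℝ)) ∞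
    (fun p ↦ TotalSpace.mk' (E →L[ℝ] E →L[ℝ] ℝ)
      (E := fun p : M ↦ TangentSpace 𝓘(ℝ, E) p →L[ℝ] TangentSpace 𝓘(ℝ, E) p →L[ℝ] ℝ)
      p (inner p))

namespace Metric

variable {E M : Type*} [NormedAddCommGroup E] [NormedSpace ℝ E]
  [TopologicalSpace M] [ChartedSpace E M] [IsManifold 𝓘(ℝ, E) ∞ M]

/-- The metric is positive definite. -/
def IsRiemannian (g : Metric E M) : Prop :=
  ∀ (p : M) (v : TangentSpace 𝓘(ℝ, E) p), v ≠ 0 → 0 < g.inner p v v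

/-- The metric has index one: at every point there is a timelike vector whose orthogonal
complement is positive definite. -/
def IsLorentzian (g : Metric E M) : Prop :=
  ∀ p : M, ∃ t : TangentSpace 𝓘(ℝ, E) p, g.inner p t t < 0 ∧
    ∀ v, g.inner p t v = 0 → v ≠ 0 → 0 < g.inner p v v

/-- The metric coefficients at `q` in the preferred chart at `p`. -/
def gram (g : Metric E M) (p q : M) : E →L[ℝ] E →L[ℝ] ℝ :=
  (coordSymm p q).precomp ℝ ∘L (g.inner q ∘L coordSymm p q)

/-- The first derivatives at `p` of the metric coefficients in the preferred chart at `p`: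
`dgram g p u` is the derivative in the direction `u`. -/
def dgram (g : Metric E M) (p : M) : TangentSpace 𝓘(ℝ, E) p →L[ℝ] E →L[ℝ] E →L[ℝ] ℝ :=
  mvfderiv 𝓘(ℝ, E) (fun q ↦ g.gram p q) p

/-- `w = Γ(u, v)` for the Christoffel symbols (of the second kind) at `p` in the preferred chart
at `p`: `2 g(Γ(u,v), z) = (∂_u g)(v, z) + (∂_v g)(u, z) - (∂_z g)(u, v)` for all `z`. -/
def IsChristoffel (g : Metric E M) (p : M) (u v w : TangentSpace 𝓘(ℝ, E) p) : Prop :=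
  ∀ z : TangentSpace 𝓘(ℝ, E) p, 2 * g.inner p w z =
    g.dgram p u (coordAt p p v) (coordAt p p z) + g.dgram p v (coordAt p p u) (coordAt p p z)
      - g.dgram p z (coordAt p p u) (coordAt p p v)

/-- The vector `Γ(u, v)` exists and is unique, by nondegeneracy of the metric. -/
theorem existsUnique_isChristoffel [FiniteDimensional ℝ E] (g : Metric E M) (p : M)
    (u v : TangentSpace 𝓘(ℝ, E) p) : ∃! w, g.IsChristoffel p u v w := by
  have hfin : FiniteDimensional ℝ (TangentSpace 𝓘(ℝ, E) p) :=
    inferInstanceAs (FiniteDimensional ℝ E)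
  let flat : TangentSpace 𝓘(ℝ, E) p →ₗ[ℝ] Module.Dual ℝ (TangentSpace 𝓘(ℝ, E) p) :=
    { toFun := fun w ↦ (g.inner p w).toLinearMap
      map_add' := fun a b ↦ by ext z; simp
      map_smul' := fun c a ↦ by ext z; simp }
  have hinj : Function.Injective flat :=
    (injective_iff_map_eq_zero flat).2 fun w hw ↦ g.nondegenerate p w fun z ↦
      LinearMap.congr_fun hw z
  have hsurj : Function.Surjective flat :=
    (LinearMap.injective_iff_surjective_of_finrank_eq_finrank
      Subspace.dual_finrank_eq.symm).1 hinj
  let κ : Module.Dual ℝ (TangentSpace 𝓘(ℝ, E) p) :=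
    { toFun := fun z ↦ (1 / 2 : ℝ) *
        (g.dgram p u (coordAt p p v) (coordAt p p z) + g.dgram p v (coordAt p p u) (coordAt p p z)
          - g.dgram p z (coordAt p p u) (coordAt p p v))
      map_add' := fun a b ↦ by
        have h1 : ∀ x y, g.dgram p (a + b) x y = g.dgram p a x y + g.dgram p b x y := fun x y ↦ by
          rw [ContinuousLinearMap.map_add]
          rfl
        rw [h1, ContinuousLinearMap.map_add (coordAt p p), ContinuousLinearMap.map_add,
          ContinuousLinearMap.map_add]
        ring
      map_smul' := fun c a ↦ by
        have h1 : ∀ x y, g.dgram p (c • a) x y = c * g.dgram p a x y := fun x y ↦ by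
          rw [ContinuousLinearMap.map_smul]
          rfl
        rw [h1, ContinuousLinearMap.map_smul (coordAt p p), ContinuousLinearMap.map_smul,
          ContinuousLinearMap.map_smul, RingHom.id_apply, smul_eq_mul, smul_eq_mul, smul_eq_mul]
        ring }
  obtain ⟨w, hw⟩ := hsurj κ
  refine ⟨w, fun z ↦ ?_, fun w' hw' ↦ hinj ?_⟩
  · have h : g.inner p w z = κ z := LinearMap.congr_fun hw z
    rw [h]
    simp only [κ, LinearMap.coe_mk, AddHom.coe_mk]
    ring
  · rw [hw]
    ext z
    have h := hw' z
    have h2 : flat w' z = g.inner p w' z := rfl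
    rw [h2]
    simp only [κ, LinearMap.coe_mk, AddHom.coe_mk]
    rw [← h]
    ring

/-- The Christoffel term `Γ(u, v)` at `p` in the preferred chart at `p`. -/
def christoffel (g : Metric E M) (p : M) (u v : TangentSpace 𝓘(ℝ, E) p) :
    TangentSpace 𝓘(ℝ, E) p :=
  Classical.epsilon fun w ↦ g.IsChristoffel p u v w

/-- The Levi-Civita covariant derivative `(∇_u Y)(p)`, computed in the preferred chart at `p`
as the directional derivative of the components of `Y` plus the Christoffel term. -/
def nabla (g : Metric E M) (p : M) (u : TangentSpace 𝓘(ℝ, E) p)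
    (Y : Π q : M, TangentSpace 𝓘(ℝ, E) q) : TangentSpace 𝓘(ℝ, E) p :=
  coordSymm p p (mvfderiv 𝓘(ℝ, E) (fun q ↦ coordAt p q (Y q)) p u)
    + g.christoffel p u (Y p)

/-- The vectors `e_i` are orthonormal: `g(e_i, e_i) = ± 1` and `g(e_i, e_j) = 0` for `i ≠ j`. -/
def IsOrthonormal (g : Metric E M) (p : M) {ι : Type*} (e : ι → TangentSpace 𝓘(ℝ, E) p) : Prop :=
  (∀ i, g.inner p (e i) (e i) = 1 ∨ g.inner p (e i) (e i) = -1) ∧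
    ∀ i j, i ≠ j → g.inner p (e i) (e j) = 0

/-- The trace of `A` on the (nondegenerate) subspace `S` of the tangent space at `p` is `c`. Here
the trace is `∑ ε_i g(A e_i, e_i)` with `ε_i = g(e_i, e_i)`, for any orthonormal basis `e` of `S`;
if `A` is linear and maps `S` to itself, it is the usual trace of `A` on `S`. -/
def HasTraceOn (g : Metric E M) (p : M) (S : Submodule ℝ (TangentSpace 𝓘(ℝ, E) p))
    (A : TangentSpace 𝓘(ℝ, E) p → TangentSpace 𝓘(ℝ, E) p) (c : ℝ) : Prop :=
  ∀ e : Basis (Fin (finrank ℝ S)) ℝ S, g.IsOrthonormal p (fun i ↦ (e i : TangentSpace 𝓘(ℝ, E) p)) →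
    ∑ i, g.inner p (e i) (e i) * g.inner p (A (e i)) (e i) = c

end Metric

section Maps

variable {E E' M N : Type*} [NormedAddCommGroup E] [NormedSpace ℝ E]
  [NormedAddCommGroup E'] [NormedSpace ℝ E']
  [TopologicalSpace M] [ChartedSpace E M] [IsManifold 𝓘(ℝ, E) ∞ M]
  [TopologicalSpace N] [ChartedSpace E' N] [IsManifold 𝓘(ℝ, E') ∞ N]

/-- The vertical space `ker F_*` at `p`. -/
def vertical (E E' : Type*) {M N : Type*} [NormedAddCommGroup E] [NormedSpace ℝ E]
    [NormedAddCommGroup E'] [NormedSpace ℝ E'] [TopologicalSpace M] [ChartedSpace E M]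
    [TopologicalSpace N] [ChartedSpace E' N] (F : M → N) (p : M) :
    Submodule ℝ (TangentSpace 𝓘(ℝ, E) p) :=
  LinearMap.ker (mfderiv 𝓘(ℝ, E) 𝓘(ℝ, E') F p).toLinearMap

/-- The orthogonal complement of the subspace `S` of the tangent space at `p`. -/
def Metric.orth (g : Metric E M) (p : M) (S : Submodule ℝ (TangentSpace 𝓘(ℝ, E) p)) :
    Submodule ℝ (TangentSpace 𝓘(ℝ, E) p) where
  carrier := {v | ∀ w ∈ S, g.inner p v w = 0}
  add_mem' {a b} ha hb w hw := by
    rw [map_add, _root_.add_apply, ha w hw, hb w hw, add_zero]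
  zero_mem' w _ := by rw [map_zero, _root_.zero_apply]
  smul_mem' c a ha w hw := by
    rw [map_smul, _root_.smul_apply, ha w hw, smul_zero]

/-- The horizontal space `(ker F_*)^⊥` at `p`. -/
def horizontal (E' : Type*) {N : Type*} [NormedAddCommGroup E'] [NormedSpace ℝ E']
    [TopologicalSpace N] [ChartedSpace E' N] (g : Metric E M) (F : M → N) (p : M) :
    Submodule ℝ (TangentSpace 𝓘(ℝ, E) p) :=
  g.orth p (vertical E E' F p)

open Classical in
/-- The orthogonal projection of the tangent space at `p` onto the vertical space. (It is set to
zero if the vertical space is degenerate, which does not occur for semi-Riemannian submersions.) -/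
def projV (E' : Type*) {N : Type*} [NormedAddCommGroup E'] [NormedSpace ℝ E']
    [TopologicalSpace N] [ChartedSpace E' N] (g : Metric E M) (F : M → N) (p : M) :
    TangentSpace 𝓘(ℝ, E) p →ₗ[ℝ] TangentSpace 𝓘(ℝ, E) p :=
  if h : IsCompl (vertical E E' F p) (horizontal E' g F p) then
    (vertical E E' F p).projection (horizontal E' g F p) h
  else 0

/-- The orthogonal projection of the tangent space at `p` onto the horizontal space. -/
def projH (E' : Type*) {N : Type*} [NormedAddCommGroup E'] [NormedSpace ℝ E']
    [TopologicalSpace N] [ChartedSpace E' N] (g : Metric E M) (F : M → N) (p : M) :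
    TangentSpace 𝓘(ℝ, E) p →ₗ[ℝ] TangentSpace 𝓘(ℝ, E) p :=
  LinearMap.id - projV E' g F p

/-- Semi-Riemannian submersion: a smooth submersion of `M` onto `N`, whose fibres are
semi-Riemannian submanifolds (their tangent spaces `ker F_*` are nondegenerate), and such that
`F_*` preserves the scalar products of vectors normal to the fibres. -/
structure IsSemiRiemannianSubmersion (g : Metric E M) (h : Metric E' N) (F : M → N) : Prop where
  contMDiff : ContMDiff 𝓘(ℝ, E) 𝓘(ℝ, E') ∞ F
  surjective : Function.Surjective F
  submersion (p : M) : Function.Surjective (mfderiv 𝓘(ℝ, E) 𝓘(ℝ, E') F p)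
  nondegenerate_fiber (p : M) : ∀ v ∈ vertical E E' F p,
    (∀ w ∈ vertical E E' F p, g.inner p v w = 0) → v = 0
  isometry (p : M) : ∀ v ∈ horizontal E' g F p, ∀ w ∈ horizontal E' g F p,
    h.inner (F p) (mfderiv 𝓘(ℝ, E) 𝓘(ℝ, E') F p v) (mfderiv 𝓘(ℝ, E) 𝓘(ℝ, E') F p w)
      = g.inner p v w

/-- O'Neill's tensor on vector fields, at the point `p`:
`T_X Y = H ∇_{V X} (V Y) + V ∇_{V X} (H Y)`, where `u = X p`. -/
def oneillTField (E' : Type*) {N : Type*} [NormedAddCommGroup E'] [NormedSpace ℝ E']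
    [TopologicalSpace N] [ChartedSpace E' N] (g : Metric E M) (F : M → N) (p : M)
    (u : TangentSpace 𝓘(ℝ, E) p) (Y : Π q : M, TangentSpace 𝓘(ℝ, E) q) :
    TangentSpace 𝓘(ℝ, E) p :=
  projH E' g F p (g.nabla p (projV E' g F p u) fun q ↦ projV E' g F q (Y q))
    + projV E' g F p (g.nabla p (projV E' g F p u) fun q ↦ projH E' g F q (Y q))

/-- O'Neill's tensor `T_u w` on tangent vectors at `p`. It is tensorial, so that any local
extension of `w` may be used; we take the one with constant components in the chart at `p`. -/
def oneillT (E' : Type*) {N : Type*} [NormedAddCommGroup E'] [NormedSpace ℝ E']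
    [TopologicalSpace N] [ChartedSpace E' N] (g : Metric E M) (F : M → N) (p : M)
    (u w : TangentSpace 𝓘(ℝ, E) p) : TangentSpace 𝓘(ℝ, E) p :=
  oneillTField E' g F p u (FiberBundle.extend E w)

/-- The pullback along `F` of the Levi-Civita connection of `h`: the derivative `∇^F_u s` at `p`
of a section `s` of `F⁻¹ TN`, computed in the preferred chart at `F p`. -/
def pullbackNabla (h : Metric E' N) (F : M → N) (p : M) (u : TangentSpace 𝓘(ℝ, E) p)
    (s : Π q : M, TangentSpace 𝓘(ℝ, E') (F q)) : TangentSpace 𝓘(ℝ, E') (F p) :=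
  coordSymm (F p) (F p)
      (mvfderiv 𝓘(ℝ, E) (fun q ↦ coordAt (F p) (F q) (s q)) p u)
    + h.christoffel (F p) (mfderiv 𝓘(ℝ, E) 𝓘(ℝ, E') F p u) (s p)

/-- The second fundamental form `(∇F_*)(X, Y) = ∇^F_X (F_* Y) - F_* (∇_X Y)` at `p`, `u = X p`. -/
def secondFormField (g : Metric E M) (h : Metric E' N) (F : M → N) (p : M)
    (u : TangentSpace 𝓘(ℝ, E) p) (Y : Π q : M, TangentSpace 𝓘(ℝ, E) q) :
    TangentSpace 𝓘(ℝ, E') (F p) :=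
  pullbackNabla h F p u (fun q ↦ mfderiv 𝓘(ℝ, E) 𝓘(ℝ, E') F q (Y q))
    - mfderiv 𝓘(ℝ, E) 𝓘(ℝ, E') F p (g.nabla p u Y)

/-- The second fundamental form on tangent vectors at `p` (it is tensorial, and evaluated with
the extension of `w` that has constant components in the chart at `p`). -/
def secondForm (g : Metric E M) (h : Metric E' N) (F : M → N) (p : M)
    (u w : TangentSpace 𝓘(ℝ, E) p) : TangentSpace 𝓘(ℝ, E') (F p) :=
  secondFormField g h F p u (FiberBundle.extend E w)

/-- `F` is harmonic: the tension field `∑ ε_i (∇F_*)(e_i, e_i)` vanishes, where `e` is an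
orthonormal basis of the tangent space and `ε_i = g(e_i, e_i)`. -/
def IsHarmonic (g : Metric E M) (h : Metric E' N) (F : M → N) : Prop :=
  ∀ (p : M) (e : Basis (Fin (finrank ℝ E)) ℝ (TangentSpace 𝓘(ℝ, E) p)), g.IsOrthonormal p e →
    ∑ i, g.inner p (e i) (e i) • secondForm g h F p (e i) (e i) = 0

end Maps

section Contact

variable {E M : Type*} [NormedAddCommGroup E] [NormedSpace ℝ E]
  [TopologicalSpace M] [ChartedSpace E M] [IsManifold 𝓘(ℝ, E) ∞ M]

/-- Lorentzian almost contact structure (`ε = -1`) or Lorentzian almost paracontact structure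
(`ε = 1`) on `(M, g)`. Smoothness of `η` follows from `eta_eq`. -/
structure LorentzianAlmostContact (ε : ℝ) (g : Metric E M) where
  lorentzian : g.IsLorentzian
  phi (p : M) : TangentSpace 𝓘(ℝ, E) p →L[ℝ] TangentSpace 𝓘(ℝ, E) p
  xi (p : M) : TangentSpace 𝓘(ℝ, E) p
  eta (p : M) : TangentSpace 𝓘(ℝ, E) p →L[ℝ] ℝ
  phi_contMDiff : ContMDiff 𝓘(ℝ, E) (𝓘(ℝ, E).prod 𝓘(ℝ, E →L[ℝ] E)) ∞
    (fun p ↦ TotalSpace.mk' (E →L[ℝ] E)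
      (E := fun p : M ↦ TangentSpace 𝓘(ℝ, E) p →L[ℝ] TangentSpace 𝓘(ℝ, E) p) p (phi p))
  xi_contMDiff : ∀ p, SmoothFieldAt xi p
  phi_phi (p : M) (v : TangentSpace 𝓘(ℝ, E) p) : phi p (phi p v) = ε • v + eta p v • xi p
  inner_phi_phi (p : M) (v w : TangentSpace 𝓘(ℝ, E) p) :
    g.inner p (phi p v) (phi p w) = g.inner p v w + eta p v * eta p w
  eta_eq (p : M) (v : TangentSpace 𝓘(ℝ, E) p) : eta p v = ε * g.inner p v (xi p)
  eta_xi (p : M) : eta p (xi p) = -ε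

/-- The Lorentzian Sasakian (`ε = -1`) or Lorentzian para Sasakian (`ε = 1`) condition
`(∇_X φ) Y = g(φ X, φ Y) ξ + ε η(Y) φ² X`, where `(∇_X φ) Y = ∇_X (φ Y) - φ (∇_X Y)`.
For `ε = -1` the right-hand side is `g(X, Y) ξ + η(Y) X`. -/
def LorentzianAlmostContact.IsSasakian {ε : ℝ} {g : Metric E M}
    (S : LorentzianAlmostContact ε g) : Prop :=
  ∀ (p : M) (u : TangentSpace 𝓘(ℝ, E) p) (Y : Π q : M, TangentSpace 𝓘(ℝ, E) q),
    SmoothFieldAt Y p →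
      g.nabla p u (fun q ↦ S.phi q (Y q)) - S.phi p (g.nabla p u Y)
        = g.inner p (S.phi p u) (S.phi p (Y p)) • S.xi p
          + (ε * S.eta p (Y p)) • S.phi p (S.phi p u)

/-- `ker F_*` is anti-invariant: `φ (ker F_*) ⊆ (ker F_*)^⊥`. -/
def LorentzianAlmostContact.IsAntiInvariant {E' N : Type*} [NormedAddCommGroup E']
    [NormedSpace ℝ E'] [TopologicalSpace N] [ChartedSpace E' N] {ε : ℝ} {g : Metric E M}
    (S : LorentzianAlmostContact ε g) (F : M → N) : Prop :=
  ∀ p : M, ∀ v ∈ vertical E E' F p, S.phi p v ∈ horizontal E' g F p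

end Contact

end

end SemiRiem

/-! Everything follows from one identity: for vertical V, tr(φ T_V) = h(F_* φV, τ) - n η(V), where τ
is the tension field (`sum_inner_phi_oneillT`).

To obtain it, pair the Sasakian formula for (∇_U φ)V with a vertical Z, where U and V are vertical
too. Since φV is horizontal, g(∇_U φV, Z) = -g(φV, ∇_U Z) = h(F_* φV, (∇F_*)(U, Z)). In g(φ ∇_U V,
Z) = ε g(∇_U V, φZ) only the horizontal part T_U V = T_V U survives. Setting U = Z = e_i and summing
with signs over a vertical orthonormal basis, the term with ξ gives g(φξ, φV) = 0, and the one with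
φ² gives ε η(V) · ε((n + 1) - 1) = n η(V), the -1 being g(ξ, ξ).

Only vertical vectors contribute to τ: the second fundamental form is symmetric, and on horizontal
vectors differentiation of h(F_* Y, F_* Z) = g(Y, Z) makes it skew in the other two slots, so it
vanishes there (`secondForm_eq_zero`, `sum_secondForm_eq`).

The hypothesis m = n enters through dimensions: the fibres have dimension n + 1 and the horizontal
spaces n, while φ has at most a one-dimensional kernel on vertical vectors. Hence ξ is vertical and
φ maps onto the horizontal space (`xi_mem_vertical_and_surjective`). The vectors F_* φV therefore
exhaust TN, and h(F_* φV, τ) = 0 for all V is equivalent to τ = 0. -/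

namespace SemiRiem

open Filter
open scoped Topology

/-! ### Derivatives of vector-valued functions on a manifold -/

section Calculus

variable {E M V W : Type*} [NormedAddCommGroup E] [NormedSpace ℝ E]
  [TopologicalSpace M] [ChartedSpace E M]
  [NormedAddCommGroup V] [NormedSpace ℝ V] [NormedAddCommGroup W] [NormedSpace ℝ W]

theorem mvfderiv_eq_fderiv {f : M → V} {p : M} (hf : MDifferentiableAt 𝓘(ℝ, E) 𝓘(ℝ, V) f p) :
    mvfderiv 𝓘(ℝ, E) f p = fderiv ℝ (f ∘ (extChartAt 𝓘(ℝ, E) p).symm) (extChartAt 𝓘(ℝ, E) p p) := by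
  ext u
  simp only [mvfderiv, hf.mfderiv]
  simp [writtenInExtChartAt, Function.comp_def]
  rfl

theorem differentiableAt_comp_extChartAt_symm {f : M → V} {p : M}
    (hf : MDifferentiableAt 𝓘(ℝ, E) 𝓘(ℝ, V) f p) :
    DifferentiableAt ℝ (f ∘ (extChartAt 𝓘(ℝ, E) p).symm) (extChartAt 𝓘(ℝ, E) p p) := by
  have h := hf.differentiableWithinAt_writtenInExtChartAt
  rw [modelWithCornersSelf_coe, Set.range_id, differentiableWithinAt_univ] at h
  exact h

/-- Product rule, inherited from the model space through the chart at `p`. Metric compatibility and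
tensoriality below both come down to it. -/
theorem mvfderiv_clm_apply {A : M → V →L[ℝ] W} {y : M → V} {p : M}
    (hA : MDifferentiableAt 𝓘(ℝ, E) 𝓘(ℝ, V →L[ℝ] W) A p)
    (hy : MDifferentiableAt 𝓘(ℝ, E) 𝓘(ℝ, V) y p) (u : TangentSpace 𝓘(ℝ, E) p) :
    mvfderiv 𝓘(ℝ, E) (fun q ↦ A q (y q)) p u
      = mvfderiv 𝓘(ℝ, E) A p u (y p) + A p (mvfderiv 𝓘(ℝ, E) y p u) := by
  have h := fderiv_clm_apply (differentiableAt_comp_extChartAt_symm hA)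
    (differentiableAt_comp_extChartAt_symm hy)
  have h2 : ((fun q ↦ A q (y q)) ∘ (extChartAt 𝓘(ℝ, E) p).symm) =
    (fun z ↦ (A ∘ (extChartAt 𝓘(ℝ, E) p).symm) z ((y ∘ (extChartAt 𝓘(ℝ, E) p).symm) z)) := rfl
  rw [mvfderiv_eq_fderiv hA, mvfderiv_eq_fderiv hy, mvfderiv_eq_fderiv (hA.clm_apply hy), h2, h,
    add_comm]
  simp only [Function.comp_apply, extChartAt_to_inv]
  rfl

theorem mvfderiv_congr {f f' : M → V} {p : M} (h : f =ᶠ[𝓝 p] f') :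
    mvfderiv 𝓘(ℝ, E) f p = mvfderiv 𝓘(ℝ, E) f' p := by
  ext u
  exact congrArg (fun L : E →L[ℝ] V ↦ L u) (h.mfderiv_eq (I := 𝓘(ℝ, E)) (I' := 𝓘(ℝ, V)))

theorem mvfderiv_comp_eq {E' N : Type*} [NormedAddCommGroup E'] [NormedSpace ℝ E']
    [TopologicalSpace N] [ChartedSpace E' N] {f : N → V} {F : M → N} {p : M}
    (hf : MDifferentiableAt 𝓘(ℝ, E') 𝓘(ℝ, V) f (F p))
    (hF : MDifferentiableAt 𝓘(ℝ, E) 𝓘(ℝ, E') F p) (u : TangentSpace 𝓘(ℝ, E) p) :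
    mvfderiv 𝓘(ℝ, E) (fun q ↦ f (F q)) p u
      = mvfderiv 𝓘(ℝ, E') f (F p) (mfderiv 𝓘(ℝ, E) 𝓘(ℝ, E') F p u) :=
  mfderiv_comp_apply p hf hF u

end Calculus

/-! ### Vector fields, metrics and differentials in the preferred charts -/

section Coordinates

variable {E M : Type*} [NormedAddCommGroup E] [NormedSpace ℝ E]
  [TopologicalSpace M] [ChartedSpace E M] [IsManifold 𝓘(ℝ, E) ∞ M]

omit [NormedSpace ℝ E] [IsManifold 𝓘(ℝ, E) ∞ M] in
theorem eventually_mem_source (p : M) : ∀ᶠ q in 𝓝 p, q ∈ (chartAt E p).source :=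
  (chartAt E p).open_source.mem_nhds (mem_chart_source E p)

theorem coordAt_coordSymm {p q : M} (hq : q ∈ (chartAt E p).source) (v : E) :
    coordAt p q (coordSymm (E := E) p q v) = v :=
  (trivializationAt E (TangentSpace 𝓘(ℝ, E)) p).continuousLinearMapAt_symmL hq v

theorem coordSymm_coordAt {p q : M} (hq : q ∈ (chartAt E p).source) (v : TangentSpace 𝓘(ℝ, E) q) :
    coordSymm p q (coordAt p q v) = v :=
  (trivializationAt E (TangentSpace 𝓘(ℝ, E)) p).symmL_continuousLinearMapAt hq v

theorem coordAt_self (p : M) (v : TangentSpace 𝓘(ℝ, E) p) : coordAt p p v = v := by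
  have h := TangentBundle.continuousLinearMapAt_trivializationAt_eq_core (I := 𝓘(ℝ, E))
    (mem_chart_source E p)
  unfold coordAt
  rw [h]
  exact (tangentBundleCore 𝓘(ℝ, E) M).coordChange_self (achart E p) p (mem_chart_source E p) v

/-- Identifies the extension used to define `oneillT` and `secondForm` with the field of constant
components near `p`, which gives its smoothness. -/
theorem extend_eq_coordSymm {p q : M} (v : TangentSpace 𝓘(ℝ, E) p)
    (hq : q ∈ (chartAt E p).source) :
    (FiberBundle.extend E v : Π q : M, TangentSpace 𝓘(ℝ, E) q) q = coordSymm p q (coordAt p p v) := by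
  have h2 : (trivializationAt E (TangentSpace 𝓘(ℝ, E)) p ⟨p, v⟩).2 = coordAt p p v := by
    unfold coordAt
    rw [Trivialization.continuousLinearMapAt_apply,
      Trivialization.coe_linearMapAt_of_mem _ (mem_chart_source E p)]
  rw [← h2]
  unfold coordSymm
  rw [Trivialization.symmL_apply _ hq]
  rfl

theorem smoothFieldAt_iff {Y : Π q : M, TangentSpace 𝓘(ℝ, E) q} {p : M} :
    SmoothFieldAt Y p ↔ ContMDiffAt 𝓘(ℝ, E) 𝓘(ℝ, E) ∞ (fun q ↦ coordAt p q (Y q)) p := by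
  unfold SmoothFieldAt
  rw [contMDiffAt_section]
  apply EventuallyEq.contMDiffAt_iff
  filter_upwards [eventually_mem_source (E := E) p] with q hq
  unfold coordAt
  rw [Trivialization.continuousLinearMapAt_apply, Trivialization.coe_linearMapAt_of_mem _ hq]

theorem smoothFieldAt_extend (p : M) (v : TangentSpace 𝓘(ℝ, E) p) :
    SmoothFieldAt (FiberBundle.extend E v : Π q : M, TangentSpace 𝓘(ℝ, E) q) p := by
  rw [smoothFieldAt_iff]
  refine (contMDiffAt_const (c := coordAt p p v)).congr_of_eventuallyEq ?_
  filter_upwards [eventually_mem_source (E := E) p] with q hq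
  rw [extend_eq_coordSymm v hq, coordAt_coordSymm hq]

namespace Metric

theorem contMDiffAt_gram (g : Metric E M) (p : M) :
    ContMDiffAt 𝓘(ℝ, E) 𝓘(ℝ, E →L[ℝ] E →L[ℝ] ℝ) ∞ (fun q ↦ g.gram p q) p := by
  have h := ((contMDiffAt_hom_bundle _).1 (g.contMDiff.contMDiffAt (x := p))).2
  refine h.congr_of_eventuallyEq ?_
  filter_upwards [eventually_mem_source (E := E) p] with q hq
  ext v w
  have hb : q ∈ (trivializationAt (E →L[ℝ] ℝ)
      (fun b : M ↦ TangentSpace 𝓘(ℝ, E) b →L[ℝ] ℝ) p).baseSet := ⟨hq, Set.mem_univ _⟩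
  simp [gram, coordSymm, ContinuousLinearMap.inCoordinates,
    Trivialization.coe_linearMapAt_of_mem _ hb, hom_trivializationAt_apply]

theorem gram_apply (g : Metric E M) (p q : M) (v w : E) :
    g.gram p q v w = g.inner q (coordSymm p q v) (coordSymm p q w) := rfl

theorem inner_eq_gram (g : Metric E M) {p q : M} (hq : q ∈ (chartAt E p).source)
    (v w : TangentSpace 𝓘(ℝ, E) q) :
    g.inner q v w = g.gram p q (coordAt p q v) (coordAt p q w) := by
  rw [gram_apply, coordSymm_coordAt hq, coordSymm_coordAt hq]

theorem gram_symm (g : Metric E M) (p q : M) (v w : E) : g.gram p q v w = g.gram p q w v :=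
  g.symm q _ _

end Metric

variable {E' N : Type*} [NormedAddCommGroup E'] [NormedSpace ℝ E']
  [TopologicalSpace N] [ChartedSpace E' N] [IsManifold 𝓘(ℝ, E') ∞ N]

/-- The differential of `F` at `q`, in the preferred charts at `p` and `F p`. -/
noncomputable def coordDeriv (E E' : Type*) {M N : Type*} [NormedAddCommGroup E] [NormedSpace ℝ E]
    [NormedAddCommGroup E'] [NormedSpace ℝ E'] [TopologicalSpace M] [ChartedSpace E M]
    [IsManifold 𝓘(ℝ, E) ∞ M] [TopologicalSpace N] [ChartedSpace E' N] [IsManifold 𝓘(ℝ, E') ∞ N]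
    (F : M → N) (p q : M) : E →L[ℝ] E' :=
  coordAt (F p) (F q) ∘L mfderiv 𝓘(ℝ, E) 𝓘(ℝ, E') F q ∘L coordSymm p q

theorem coordAt_mfderiv {F : M → N} {p q : M} (hq : q ∈ (chartAt E p).source)
    (v : TangentSpace 𝓘(ℝ, E) q) :
    coordAt (F p) (F q) (mfderiv 𝓘(ℝ, E) 𝓘(ℝ, E') F q v)
      = coordDeriv E E' F p q (coordAt p q v) := by
  change _ = coordAt (F p) (F q) (mfderiv 𝓘(ℝ, E) 𝓘(ℝ, E') F q (coordSymm p q (coordAt p q v)))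
  rw [coordSymm_coordAt hq]

theorem contMDiffAt_coordDeriv {F : M → N} {p : M}
    (hF : ContMDiffAt 𝓘(ℝ, E) 𝓘(ℝ, E') ∞ F p) :
    ContMDiffAt 𝓘(ℝ, E) 𝓘(ℝ, E →L[ℝ] E') ∞ (fun q ↦ coordDeriv E E' F p q) p :=
  hF.mfderiv_const (m := ∞) (by simp)

/-- The tangent trivializations are the derivatives of the charts, so this is the chain rule for the
map written in charts. -/
theorem coordDeriv_eq_fderiv {F : M → N} {p q : M}
    (hF : MDifferentiableAt 𝓘(ℝ, E) 𝓘(ℝ, E') F q) (hq : q ∈ (chartAt E p).source)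
    (hFq : F q ∈ (chartAt E' (F p)).source) :
    coordDeriv E E' F p q = fderiv ℝ
      (extChartAt 𝓘(ℝ, E') (F p) ∘ F ∘ (extChartAt 𝓘(ℝ, E) p).symm) (extChartAt 𝓘(ℝ, E) p q) := by
  have hq' : q ∈ (extChartAt 𝓘(ℝ, E) p).source := by rwa [extChartAt_source]
  have h1 := TangentBundle.continuousLinearMapAt_trivializationAt (I := 𝓘(ℝ, E')) hFq
  have h2 := TangentBundle.symmL_trivializationAt (I := 𝓘(ℝ, E)) hq
  have hz := (extChartAt 𝓘(ℝ, E) p).left_inv hq'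
  rw [modelWithCornersSelf_coe, Set.range_id, mfderivWithin_univ] at h2
  have d2 : MDifferentiableAt 𝓘(ℝ, E) 𝓘(ℝ, E) (extChartAt 𝓘(ℝ, E) p).symm
      (extChartAt 𝓘(ℝ, E) p q) := by
    have := mdifferentiableWithinAt_extChartAt_symm (I := 𝓘(ℝ, E))
      ((extChartAt 𝓘(ℝ, E) p).map_source hq')
    rwa [modelWithCornersSelf_coe, Set.range_id, mdifferentiableWithinAt_univ] at this
  have d1 : MDifferentiableAt 𝓘(ℝ, E') 𝓘(ℝ, E') (extChartAt 𝓘(ℝ, E') (F p)) (F q) :=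
    mdifferentiableAt_extChartAt hFq
  -- The chain rule wants the base point in the form chart inverse of chart of `q`; since tangent
  -- spaces depend on the point, the derivatives are restated there.
  have hF' : HasMFDerivAt 𝓘(ℝ, E) 𝓘(ℝ, E') F
      ((extChartAt 𝓘(ℝ, E) p).symm (extChartAt 𝓘(ℝ, E) p q))
      (mfderiv 𝓘(ℝ, E) 𝓘(ℝ, E') F q : E →L[ℝ] E') := by
    rw [hz]
    exact hF.hasMFDerivAt
  have d1' : HasMFDerivAt 𝓘(ℝ, E') 𝓘(ℝ, E') (extChartAt 𝓘(ℝ, E') (F p))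
      ((F ∘ (extChartAt 𝓘(ℝ, E) p).symm) (extChartAt 𝓘(ℝ, E) p q))
      (mfderiv 𝓘(ℝ, E') 𝓘(ℝ, E') (extChartAt 𝓘(ℝ, E') (F p)) (F q) : E' →L[ℝ] E') := by
    rw [Function.comp_apply, hz]
    exact d1.hasMFDerivAt
  have c := d1'.comp _ (hF'.comp _ d2.hasMFDerivAt)
  rw [← mfderiv_eq_fderiv, c.mfderiv]
  unfold coordDeriv coordAt coordSymm
  rw [h1, h2]
  rfl

/-- Symmetry of second derivatives of `F` written in charts. With the symmetry of the Christoffel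
terms it makes the second fundamental form symmetric. -/
theorem mvfderiv_coordDeriv_symm {F : M → N} {p : M}
    (hF : ContMDiff 𝓘(ℝ, E) 𝓘(ℝ, E') ∞ F) (u v : TangentSpace 𝓘(ℝ, E) p) :
    mvfderiv 𝓘(ℝ, E) (fun q ↦ coordDeriv E E' F p q) p u v
      = mvfderiv 𝓘(ℝ, E) (fun q ↦ coordDeriv E E' F p q) p v u := by
  set f := extChartAt 𝓘(ℝ, E') (F p) ∘ F ∘ (extChartAt 𝓘(ℝ, E) p).symm with hf
  have hsm : ContDiffAt ℝ ∞ f (extChartAt 𝓘(ℝ, E) p p) := by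
    have := (contMDiffAt_iff.1 (hF.contMDiffAt (x := p))).2
    rwa [modelWithCornersSelf_coe, Set.range_id, contDiffWithinAt_univ] at this
  have hd := (contMDiffAt_coordDeriv (hF.contMDiffAt (x := p))).mdifferentiableAt (by simp)
  have heq : (fun q ↦ coordDeriv E E' F p q) ∘ (extChartAt 𝓘(ℝ, E) p).symm
      =ᶠ[𝓝 (extChartAt 𝓘(ℝ, E) p p)] fderiv ℝ f := by
    have hev : ∀ᶠ q in 𝓝 p, q ∈ (chartAt E p).source ∧ F q ∈ (chartAt E' (F p)).source :=
      (eventually_mem_source p).and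
        (hF.continuous.continuousAt.eventually (eventually_mem_source (F p)))
    have hc : Tendsto (extChartAt 𝓘(ℝ, E) p).symm (𝓝 (extChartAt 𝓘(ℝ, E) p p)) (𝓝 p) := by
      have := continuousAt_extChartAt_symm (I := 𝓘(ℝ, E)) p
      rwa [ContinuousAt, extChartAt_to_inv] at this
    filter_upwards [hc.eventually hev, extChartAt_target_mem_nhds (I := 𝓘(ℝ, E)) p] with z hz hzt
    rw [Function.comp_apply, coordDeriv_eq_fderiv ((hF _).mdifferentiableAt (by simp)) hz.1 hz.2,
      (extChartAt 𝓘(ℝ, E) p).right_inv hzt]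
  rw [mvfderiv_eq_fderiv hd, heq.fderiv_eq]
  exact hsm.isSymmSndFDerivAt
    (by rw [minSmoothness_of_isRCLikeNormedField]; exact ENat.LEInfty.out) u v

end Coordinates

/-! ### Christoffel symbols and compatibility with the metric -/

section LeviCivita

variable {E M : Type*} [NormedAddCommGroup E] [NormedSpace ℝ E]
  [TopologicalSpace M] [ChartedSpace E M] [IsManifold 𝓘(ℝ, E) ∞ M]

namespace Metric

theorem mdifferentiableAt_gram (g : Metric E M) (p : M) :
    MDifferentiableAt 𝓘(ℝ, E) 𝓘(ℝ, E →L[ℝ] E →L[ℝ] ℝ) (fun q ↦ g.gram p q) p :=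
  (g.contMDiffAt_gram p).mdifferentiableAt (by simp)

theorem dgram_apply (g : Metric E M) (p : M) (u : TangentSpace 𝓘(ℝ, E) p) (a b : E) :
    g.dgram p u a b = mvfderiv 𝓘(ℝ, E) (fun q ↦ g.gram p q a b) p u := by
  have ha : MDifferentiableAt 𝓘(ℝ, E) 𝓘(ℝ, E) (fun _ : M ↦ a) p := mdifferentiableAt_const
  have hb : MDifferentiableAt 𝓘(ℝ, E) 𝓘(ℝ, E) (fun _ : M ↦ b) p := mdifferentiableAt_const
  rw [mvfderiv_clm_apply ((g.mdifferentiableAt_gram p).clm_apply ha) hb,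
    mvfderiv_clm_apply (g.mdifferentiableAt_gram p) ha, mvfderiv_const, mvfderiv_const]
  simp [dgram]

theorem dgram_symm (g : Metric E M) (p : M) (u : TangentSpace 𝓘(ℝ, E) p) (a b : E) :
    g.dgram p u a b = g.dgram p u b a := by
  simp_rw [dgram_apply, g.gram_symm p _ a b]

variable [FiniteDimensional ℝ E]

theorem isChristoffel_christoffel (g : Metric E M) (p : M) (u v : TangentSpace 𝓘(ℝ, E) p) :
    g.IsChristoffel p u v (g.christoffel p u v) :=
  Classical.epsilon_spec (g.existsUnique_isChristoffel p u v).exists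

theorem christoffel_eq_of_isChristoffel {g : Metric E M} {p : M}
    {u v w : TangentSpace 𝓘(ℝ, E) p} (h : g.IsChristoffel p u v w) : g.christoffel p u v = w :=
  (g.existsUnique_isChristoffel p u v).unique (g.isChristoffel_christoffel p u v) h

/-- Torsion-freeness: exchanging u and v swaps the first two terms of the defining formula and fixes
the third, by symmetry of the metric. -/
theorem christoffel_symm (g : Metric E M) (p : M) (u v : TangentSpace 𝓘(ℝ, E) p) :
    g.christoffel p u v = g.christoffel p v u := by
  refine christoffel_eq_of_isChristoffel fun z ↦ ?_
  rw [g.isChristoffel_christoffel p v u z, g.dgram_symm p z (coordAt p p u)]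
  ring

theorem christoffel_add_right (g : Metric E M) (p : M) (u v w : TangentSpace 𝓘(ℝ, E) p) :
    g.christoffel p u (v + w) = g.christoffel p u v + g.christoffel p u w := by
  refine christoffel_eq_of_isChristoffel fun z ↦ ?_
  have h1 := g.isChristoffel_christoffel p u v z
  have h2 := g.isChristoffel_christoffel p u w z
  have hd : g.dgram p (v + w) (coordAt p p u) (coordAt p p z)
      = g.dgram p v (coordAt p p u) (coordAt p p z)
        + g.dgram p w (coordAt p p u) (coordAt p p z) := by
    rw [ContinuousLinearMap.map_add]
    rfl
  rw [hd, ContinuousLinearMap.map_add, ContinuousLinearMap.map_add (coordAt p p),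
    ContinuousLinearMap.map_add, ContinuousLinearMap.map_add, add_apply, add_apply]
  linear_combination h1 + h2

theorem christoffel_smul_right (g : Metric E M) (p : M) (u v : TangentSpace 𝓘(ℝ, E) p) (c : ℝ) :
    g.christoffel p u (c • v) = c • g.christoffel p u v := by
  refine christoffel_eq_of_isChristoffel fun z ↦ ?_
  have h1 := g.isChristoffel_christoffel p u v z
  have hd : g.dgram p (c • v) (coordAt p p u) (coordAt p p z)
      = c * g.dgram p v (coordAt p p u) (coordAt p p z) := by
    rw [ContinuousLinearMap.map_smul]
    rfl
  rw [hd, ContinuousLinearMap.map_smul, ContinuousLinearMap.map_smul (coordAt p p),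
    ContinuousLinearMap.map_smul, ContinuousLinearMap.map_smul, smul_apply, smul_apply,
    smul_eq_mul, smul_eq_mul, smul_eq_mul]
  linear_combination c * h1

/-- Metric compatibility in coordinates: in the sum of the defining formulas for Γ(u, v) and Γ(u,
w), four of the six derivatives cancel. -/
theorem dgram_eq_inner_christoffel (g : Metric E M) (p : M) (u v w : TangentSpace 𝓘(ℝ, E) p) :
    g.dgram p u (coordAt p p v) (coordAt p p w)
      = g.inner p (g.christoffel p u v) w + g.inner p v (g.christoffel p u w) := by
  have h1 := g.isChristoffel_christoffel p u v w
  have h2 := g.isChristoffel_christoffel p u w v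
  rw [g.symm p _ v] at h2
  rw [g.dgram_symm p u (coordAt p p w)] at h2
  linear_combination (-1 / 2) * (h1 + h2)

variable {E' N : Type*} [NormedAddCommGroup E'] [NormedSpace ℝ E'] [FiniteDimensional ℝ E']
  [TopologicalSpace N] [ChartedSpace E' N] [IsManifold 𝓘(ℝ, E') ∞ N]

omit [FiniteDimensional ℝ E] [IsManifold 𝓘(ℝ, E) ∞ M] in
/-- The pullback connection is compatible with the metric. -/
theorem mvfderiv_inner_pullback (h : Metric E' N) {F : M → N} {p : M}
    (hF : MDifferentiableAt 𝓘(ℝ, E) 𝓘(ℝ, E') F p) {s t : Π q : M, TangentSpace 𝓘(ℝ, E') (F q)}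
    (hs : MDifferentiableAt 𝓘(ℝ, E) 𝓘(ℝ, E') (fun q ↦ coordAt (F p) (F q) (s q)) p)
    (ht : MDifferentiableAt 𝓘(ℝ, E) 𝓘(ℝ, E') (fun q ↦ coordAt (F p) (F q) (t q)) p)
    (u : TangentSpace 𝓘(ℝ, E) p) :
    mvfderiv 𝓘(ℝ, E) (fun q ↦ h.inner (F q) (s q) (t q)) p u
      = h.inner (F p) (pullbackNabla h F p u s) (t p)
        + h.inner (F p) (s p) (pullbackNabla h F p u t) := by
  have hG : MDifferentiableAt 𝓘(ℝ, E) 𝓘(ℝ, E' →L[ℝ] E' →L[ℝ] ℝ)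
      (fun q ↦ h.gram (F p) (F q)) p := (h.mdifferentiableAt_gram (F p)).comp p hF
  have heq : (fun q ↦ h.inner (F q) (s q) (t q)) =ᶠ[𝓝 p] fun q ↦
      h.gram (F p) (F q) (coordAt (F p) (F q) (s q)) (coordAt (F p) (F q) (t q)) := by
    filter_upwards [hF.continuousAt.eventually (eventually_mem_source (E := E') (F p))] with q hq
    exact h.inner_eq_gram hq _ _
  have hd : mvfderiv 𝓘(ℝ, E) (fun q ↦ h.gram (F p) (F q)) p u
      = h.dgram (F p) (mfderiv 𝓘(ℝ, E) 𝓘(ℝ, E') F p u) :=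
    mvfderiv_comp_eq (h.mdifferentiableAt_gram (F p)) hF u
  rw [mvfderiv_congr heq, mvfderiv_clm_apply (hG.clm_apply hs) ht, mvfderiv_clm_apply hG hs, hd,
    add_apply, dgram_eq_inner_christoffel]
  simp only [pullbackNabla, map_add, add_apply]
  rw [gram_apply, gram_apply, coordSymm_coordAt (mem_chart_source E' (F p)),
    coordSymm_coordAt (mem_chart_source E' (F p))]
  ring

omit [FiniteDimensional ℝ E] in
-- Makes compatibility of the Levi-Civita connection a special case of that of the pullback
-- connection.
theorem pullbackNabla_id (g : Metric E M) (p : M) (u : TangentSpace 𝓘(ℝ, E) p)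
    (Y : Π q : M, TangentSpace 𝓘(ℝ, E) q) :
    pullbackNabla g (id : M → M) p u Y = g.nabla p u Y := by
  unfold pullbackNabla nabla
  rw [mfderiv_id]
  rfl

/-- The Levi-Civita connection is compatible with the metric. -/
theorem mvfderiv_inner (g : Metric E M) {p : M} {Y Z : Π q : M, TangentSpace 𝓘(ℝ, E) q}
    (hY : SmoothFieldAt Y p) (hZ : SmoothFieldAt Z p) (u : TangentSpace 𝓘(ℝ, E) p) :
    mvfderiv 𝓘(ℝ, E) (fun q ↦ g.inner q (Y q) (Z q)) p u
      = g.inner p (g.nabla p u Y) (Z p) + g.inner p (Y p) (g.nabla p u Z) := by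
  rw [← pullbackNabla_id, ← pullbackNabla_id]
  exact g.mvfderiv_inner_pullback (F := id) mdifferentiableAt_id
    ((smoothFieldAt_iff.1 hY).mdifferentiableAt (by simp))
    ((smoothFieldAt_iff.1 hZ).mdifferentiableAt (by simp)) u

end Metric

end LeviCivita

/-! ### The second fundamental form of a smooth map: tensoriality, symmetry, bilinearity -/

section SecondForm

variable {E E' M N : Type*} [NormedAddCommGroup E] [NormedSpace ℝ E] [FiniteDimensional ℝ E]
  [NormedAddCommGroup E'] [NormedSpace ℝ E'] [FiniteDimensional ℝ E']
  [TopologicalSpace M] [ChartedSpace E M] [IsManifold 𝓘(ℝ, E) ∞ M]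
  [TopologicalSpace N] [ChartedSpace E' N] [IsManifold 𝓘(ℝ, E') ∞ N]

omit [FiniteDimensional ℝ E] [FiniteDimensional ℝ E'] in
-- The product rule yields the derivative of F_* applied to Y plus F_* applied to the derivative of
-- Y; the latter cancels against its copy in F_*(∇_u Y). What remains sees Y only through its value
-- at `p`.
theorem secondFormField_eq (g : Metric E M) (h : Metric E' N) {F : M → N}
    (hF : ContMDiff 𝓘(ℝ, E) 𝓘(ℝ, E') ∞ F) {p : M} (u : TangentSpace 𝓘(ℝ, E) p)
    {Y : Π q : M, TangentSpace 𝓘(ℝ, E) q} (hY : SmoothFieldAt Y p) :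
    secondFormField g h F p u Y
      = coordSymm (F p) (F p)
          (mvfderiv 𝓘(ℝ, E) (fun q ↦ coordDeriv E E' F p q) p u (coordAt p p (Y p)))
        + h.christoffel (F p) (mfderiv 𝓘(ℝ, E) 𝓘(ℝ, E') F p u)
            (mfderiv 𝓘(ℝ, E) 𝓘(ℝ, E') F p (Y p))
        - mfderiv 𝓘(ℝ, E) 𝓘(ℝ, E') F p (g.christoffel p u (Y p)) := by
  have heq : (fun q ↦ coordAt (F p) (F q) (mfderiv 𝓘(ℝ, E) 𝓘(ℝ, E') F q (Y q)))
      =ᶠ[𝓝 p] fun q ↦ coordDeriv E E' F p q (coordAt p q (Y q)) := by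
    filter_upwards [eventually_mem_source (E := E) p] with q hq
    exact coordAt_mfderiv hq _
  have hA := (contMDiffAt_coordDeriv (hF.contMDiffAt (x := p))).mdifferentiableAt (by simp)
  have hy := (smoothFieldAt_iff.1 hY).mdifferentiableAt (by simp)
  unfold secondFormField pullbackNabla Metric.nabla
  rw [mvfderiv_congr heq, mvfderiv_clm_apply hA hy, map_add, map_add]
  have h1 : coordSymm (F p) (F p) (coordDeriv E E' F p p
      (mvfderiv 𝓘(ℝ, E) (fun q ↦ coordAt p q (Y q)) p u))
      = mfderiv 𝓘(ℝ, E) 𝓘(ℝ, E') F p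
        (coordSymm p p (mvfderiv 𝓘(ℝ, E) (fun q ↦ coordAt p q (Y q)) p u)) :=
    coordSymm_coordAt (mem_chart_source E' (F p)) _
  rw [h1]
  abel

omit [FiniteDimensional ℝ E] [FiniteDimensional ℝ E'] in
theorem secondForm_eq (g : Metric E M) (h : Metric E' N) {F : M → N}
    (hF : ContMDiff 𝓘(ℝ, E) 𝓘(ℝ, E') ∞ F) {p : M} (u w : TangentSpace 𝓘(ℝ, E) p) :
    secondForm g h F p u w
      = coordSymm (F p) (F p)
          (mvfderiv 𝓘(ℝ, E) (fun q ↦ coordDeriv E E' F p q) p u (coordAt p p w))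
        + h.christoffel (F p) (mfderiv 𝓘(ℝ, E) 𝓘(ℝ, E') F p u)
            (mfderiv 𝓘(ℝ, E) 𝓘(ℝ, E') F p w)
        - mfderiv 𝓘(ℝ, E) 𝓘(ℝ, E') F p (g.christoffel p u w) := by
  unfold secondForm
  rw [secondFormField_eq g h hF u (smoothFieldAt_extend p w), FiberBundle.extend_apply_self]

omit [FiniteDimensional ℝ E] [FiniteDimensional ℝ E'] in
/-- The second fundamental form is tensorial. -/
theorem secondFormField_eq_secondForm (g : Metric E M) (h : Metric E' N) {F : M → N}
    (hF : ContMDiff 𝓘(ℝ, E) 𝓘(ℝ, E') ∞ F) {p : M} (u : TangentSpace 𝓘(ℝ, E) p)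
    {Y : Π q : M, TangentSpace 𝓘(ℝ, E) q} (hY : SmoothFieldAt Y p) :
    secondFormField g h F p u Y = secondForm g h F p u (Y p) := by
  rw [secondForm_eq g h hF, secondFormField_eq g h hF u hY]

theorem secondForm_symm (g : Metric E M) (h : Metric E' N) {F : M → N}
    (hF : ContMDiff 𝓘(ℝ, E) 𝓘(ℝ, E') ∞ F) {p : M} (u w : TangentSpace 𝓘(ℝ, E) p) :
    secondForm g h F p u w = secondForm g h F p w u := by
  rw [secondForm_eq g h hF, secondForm_eq g h hF, h.christoffel_symm, g.christoffel_symm,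
    coordAt_self, coordAt_self, mvfderiv_coordDeriv_symm hF]

theorem secondForm_add_right (g : Metric E M) (h : Metric E' N) {F : M → N}
    (hF : ContMDiff 𝓘(ℝ, E) 𝓘(ℝ, E') ∞ F) {p : M} (u v w : TangentSpace 𝓘(ℝ, E) p) :
    secondForm g h F p u (v + w) = secondForm g h F p u v + secondForm g h F p u w := by
  simp only [secondForm_eq g h hF, map_add, Metric.christoffel_add_right]
  abel

theorem secondForm_smul_right (g : Metric E M) (h : Metric E' N) {F : M → N}
    (hF : ContMDiff 𝓘(ℝ, E) 𝓘(ℝ, E') ∞ F) {p : M} (c : ℝ) (u w : TangentSpace 𝓘(ℝ, E) p) :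
    secondForm g h F p u (c • w) = c • secondForm g h F p u w := by
  simp only [secondForm_eq g h hF, map_smul, Metric.christoffel_smul_right, smul_add, smul_sub]

/-- The second fundamental form of a smooth map as a bilinear map. -/
noncomputable def secondFormBilin (g : Metric E M) (h : Metric E' N) {F : M → N}
    (hF : ContMDiff 𝓘(ℝ, E) 𝓘(ℝ, E') ∞ F) (p : M) :
    TangentSpace 𝓘(ℝ, E) p →ₗ[ℝ] TangentSpace 𝓘(ℝ, E) p →ₗ[ℝ] TangentSpace 𝓘(ℝ, E') (F p) :=
  LinearMap.mk₂ ℝ (secondForm g h F p)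
    (fun u v w ↦ by
      rw [secondForm_symm g h hF, secondForm_add_right g h hF, secondForm_symm g h hF w,
        secondForm_symm g h hF w])
    (fun c u v ↦ by
      rw [secondForm_symm g h hF, secondForm_smul_right g h hF, secondForm_symm g h hF v])
    (secondForm_add_right g h hF)
    (fun c u v ↦ secondForm_smul_right g h hF c u v)

end SecondForm

theorem finiteDimensional_tangentSpace {E M : Type*} [NormedAddCommGroup E] [NormedSpace ℝ E]
    [FiniteDimensional ℝ E] [TopologicalSpace M] [ChartedSpace E M] (p : M) :
    FiniteDimensional ℝ (TangentSpace 𝓘(ℝ, E) p) :=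
  inferInstanceAs (FiniteDimensional ℝ E)

/-! ### Linear algebra of an indefinite scalar product -/

namespace Metric

variable {E M : Type*} [NormedAddCommGroup E] [NormedSpace ℝ E]
  [TopologicalSpace M] [ChartedSpace E M] [IsManifold 𝓘(ℝ, E) ∞ M]

/-- The scalar product at `p` as an algebraic bilinear form. -/
noncomputable def bilin (g : Metric E M) (p : M) :
    LinearMap.BilinForm ℝ (TangentSpace 𝓘(ℝ, E) p) :=
  LinearMap.mk₂ ℝ (fun v w ↦ g.inner p v w)
    (fun u v w ↦ by rw [map_add, add_apply]) (fun c u v ↦ by rw [map_smul, smul_apply])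
    (fun u v w ↦ map_add _ _ _) (fun c u v ↦ map_smul _ _ _)

theorem bilin_apply (g : Metric E M) (p : M) (v w : TangentSpace 𝓘(ℝ, E) p) :
    g.bilin p v w = g.inner p v w := rfl

theorem bilin_isSymm (g : Metric E M) (p : M) : (g.bilin p).IsSymm :=
  ⟨fun v w ↦ g.symm p v w⟩

theorem orth_eq_orthogonal (g : Metric E M) (p : M)
    (S : Submodule ℝ (TangentSpace 𝓘(ℝ, E) p)) : g.orth p S = (g.bilin p).orthogonal S := by
  ext v
  exact forall₂_congr fun w _ ↦ by
    change g.inner p v w = 0 ↔ g.inner p w v = 0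
    rw [g.symm]

/-- For an indefinite metric a subspace may meet its orthogonal complement; nondegeneracy on `S`
excludes exactly this. -/
theorem isCompl_orth [FiniteDimensional ℝ E] (g : Metric E M) (p : M)
    (S : Submodule ℝ (TangentSpace 𝓘(ℝ, E) p))
    (hS : ∀ v ∈ S, (∀ w ∈ S, g.inner p v w = 0) → v = 0) : IsCompl S (g.orth p S) := by
  have := finiteDimensional_tangentSpace (E := E) p
  rw [orth_eq_orthogonal, LinearMap.BilinForm.isCompl_orthogonal_iff_disjoint
    (g.bilin_isSymm p).isRefl, ← orth_eq_orthogonal, Submodule.disjoint_def]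
  exact fun v hv hv' ↦ hS v hv hv'

/-- Invertibility of the metric coefficients, needed to raise an index smoothly in
`smoothFieldAt_projH`. -/
theorem exists_gram_eq_equiv [FiniteDimensional ℝ E] (g : Metric E M) {p q : M}
    (hq : q ∈ (chartAt E p).source) :
    ∃ e : E ≃L[ℝ] (E →L[ℝ] ℝ), (e : E →L[ℝ] E →L[ℝ] ℝ) = g.gram p q := by
  have hfin : finrank ℝ E = finrank ℝ (E →L[ℝ] ℝ) := by
    rw [← (LinearMap.toContinuousLinearMap (𝕜 := ℝ) (E := E) (F' := ℝ)).finrank_eq]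
    exact Subspace.dual_finrank_eq.symm
  have hinj : Function.Injective (g.gram p q).toLinearMap := by
    refine (injective_iff_map_eq_zero _).2 fun v hv ↦ ?_
    have h0 : coordSymm p q v = 0 := g.nondegenerate q _ fun w ↦ by
      have h1 : g.gram p q v (coordAt p q w) = 0 := by
        rw [show g.gram p q v = 0 from hv, zero_apply]
      rwa [gram_apply, coordSymm_coordAt hq] at h1
    rw [← coordAt_coordSymm hq v, h0, map_zero]
  exact ⟨(LinearEquiv.ofInjectiveOfFinrankEq _ hinj hfin).toContinuousLinearEquiv, rfl⟩

end Metric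

/-! ### Horizontal and vertical parts, O'Neill's tensor, and the second fundamental form -/

section Submersion

variable {E E' M N : Type*} [NormedAddCommGroup E] [NormedSpace ℝ E] [FiniteDimensional ℝ E]
  [NormedAddCommGroup E'] [NormedSpace ℝ E']
  [TopologicalSpace M] [ChartedSpace E M] [IsManifold 𝓘(ℝ, E) ∞ M]
  [TopologicalSpace N] [ChartedSpace E' N] [IsManifold 𝓘(ℝ, E') ∞ N]

omit [FiniteDimensional ℝ E] [IsManifold 𝓘(ℝ, E) ∞ M] [IsManifold 𝓘(ℝ, E') ∞ N] in
theorem mem_vertical {F : M → N} {p : M} {v : TangentSpace 𝓘(ℝ, E) p} :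
    v ∈ vertical E E' F p ↔ mfderiv 𝓘(ℝ, E) 𝓘(ℝ, E') F p v = 0 := Iff.rfl

namespace IsSemiRiemannianSubmersion

variable {g : Metric E M} {h : Metric E' N} {F : M → N} (hF : IsSemiRiemannianSubmersion g h F)
include hF

theorem isCompl (p : M) : IsCompl (vertical E E' F p) (horizontal E' g F p) :=
  g.isCompl_orth p _ (hF.nondegenerate_fiber p)

theorem projV_apply (p : M) (v : TangentSpace 𝓘(ℝ, E) p) :
    projV E' g F p v = (vertical E E' F p).projection (horizontal E' g F p) (hF.isCompl p) v := by
  rw [projV, dif_pos (hF.isCompl p)]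

theorem projV_mem (p : M) (v : TangentSpace 𝓘(ℝ, E) p) :
    projV E' g F p v ∈ vertical E E' F p := by
  rw [hF.projV_apply]
  exact Submodule.projection_apply_mem _ _

theorem projV_of_mem {p : M} {v : TangentSpace 𝓘(ℝ, E) p} (hv : v ∈ vertical E E' F p) :
    projV E' g F p v = v := by
  rw [hF.projV_apply]
  exact Submodule.projection_apply_of_mem_left _ hv

theorem projV_of_mem_horizontal {p : M} {v : TangentSpace 𝓘(ℝ, E) p}
    (hv : v ∈ horizontal E' g F p) : projV E' g F p v = 0 := by
  rw [hF.projV_apply]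
  exact Submodule.projection_apply_of_mem_right _ hv

omit hF [FiniteDimensional ℝ E] [IsManifold 𝓘(ℝ, E') ∞ N] in
theorem _root_.SemiRiem.projH_apply (p : M) (v : TangentSpace 𝓘(ℝ, E) p) :
    projH E' g F p v = v - projV E' g F p v := rfl

theorem projH_mem (p : M) (v : TangentSpace 𝓘(ℝ, E) p) :
    projH E' g F p v ∈ horizontal E' g F p := by
  rw [projH_apply]
  have h1 := (hF.isCompl p).sup_eq_top
  obtain ⟨a, ha, b, hb, rfl⟩ := Submodule.mem_sup.1 (h1 ▸ Submodule.mem_top : v ∈ _)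
  rwa [map_add, hF.projV_of_mem ha, hF.projV_of_mem_horizontal hb, add_zero, add_sub_cancel_left]

theorem projH_of_mem {p : M} {v : TangentSpace 𝓘(ℝ, E) p} (hv : v ∈ horizontal E' g F p) :
    projH E' g F p v = v := by
  rw [projH_apply, hF.projV_of_mem_horizontal hv, sub_zero]

theorem projH_of_mem_vertical {p : M} {v : TangentSpace 𝓘(ℝ, E) p}
    (hv : v ∈ vertical E E' F p) : projH E' g F p v = 0 := by
  rw [projH_apply, hF.projV_of_mem hv, sub_self]

theorem mfderiv_projH (p : M) (v : TangentSpace 𝓘(ℝ, E) p) :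
    mfderiv 𝓘(ℝ, E) 𝓘(ℝ, E') F p (projH E' g F p v) = mfderiv 𝓘(ℝ, E) 𝓘(ℝ, E') F p v := by
  rw [projH_apply, map_sub, mem_vertical.1 (hF.projV_mem p v), sub_zero]

/-- Characterizes the horizontal part of v by the covector w ↦ h(F_* v, F_* w), an expression free
of projections and visibly smooth in the point. -/
theorem inner_mfderiv (p : M) (v w : TangentSpace 𝓘(ℝ, E) p) :
    h.inner (F p) (mfderiv 𝓘(ℝ, E) 𝓘(ℝ, E') F p v) (mfderiv 𝓘(ℝ, E) 𝓘(ℝ, E') F p w)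
      = g.inner p (projH E' g F p v) w := by
  rw [← hF.mfderiv_projH p v, ← hF.mfderiv_projH p w,
    hF.isometry p _ (hF.projH_mem p v) _ (hF.projH_mem p w), projH_apply p w, map_sub,
    hF.projH_mem p v _ (hF.projV_mem p w), sub_zero]

theorem inner_mfderiv_of_mem {p : M} {v : TangentSpace 𝓘(ℝ, E) p}
    (hv : v ∈ horizontal E' g F p) (w : TangentSpace 𝓘(ℝ, E) p) :
    h.inner (F p) (mfderiv 𝓘(ℝ, E) 𝓘(ℝ, E') F p v) (mfderiv 𝓘(ℝ, E) 𝓘(ℝ, E') F p w)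
      = g.inner p v w := by
  rw [hF.inner_mfderiv, hF.projH_of_mem hv]

/-- The horizontal part of a smooth vector field is smooth. -/
theorem smoothFieldAt_projH {Y : Π q : M, TangentSpace 𝓘(ℝ, E) q} {p : M}
    (hY : SmoothFieldAt Y p) : SmoothFieldAt (fun q ↦ projH E' g F q (Y q)) p := by
  rw [smoothFieldAt_iff] at hY ⊢
  have hFp := hF.contMDiff.contMDiffAt (x := p)
  have hA := contMDiffAt_coordDeriv hFp
  have hη : ContMDiffAt 𝓘(ℝ, E) 𝓘(ℝ, E' →L[ℝ] E' →L[ℝ] ℝ) ∞ (fun q ↦ h.gram (F p) (F q)) p :=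
    (h.contMDiffAt_gram (F p)).comp p hFp
  -- The covector w ↦ h(F_* Y, F_* w) in coordinates. By `inner_mfderiv` it equals g(H Y, ·), so
  -- applying the inverse metric recovers H Y.
  have hR : ContMDiffAt 𝓘(ℝ, E) 𝓘(ℝ, E →L[ℝ] ℝ) ∞ (fun q ↦ (h.gram (F p) (F q)
      (coordDeriv E E' F p q (coordAt p q (Y q)))).comp (coordDeriv E E' F p q)) p :=
    (hη.clm_apply (hA.clm_apply hY)).clm_comp hA
  have hI : ContMDiffAt 𝓘(ℝ, E) 𝓘(ℝ, (E →L[ℝ] ℝ) →L[ℝ] E) ∞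
      (fun q ↦ ContinuousLinearMap.inverse (g.gram p q)) p := by
    obtain ⟨e, he⟩ := g.exists_gram_eq_equiv (mem_chart_source E p)
    have : CompleteSpace E := FiniteDimensional.complete ℝ E
    have h1 := contDiffAt_map_inverse (n := ∞) e
    rw [he] at h1
    exact h1.contMDiffAt.comp p (g.contMDiffAt_gram p)
  refine (hI.clm_apply hR).congr_of_eventuallyEq ?_
  filter_upwards [eventually_mem_source (E := E) p,
    hFp.continuousAt.eventually (eventually_mem_source (E := E') (F p))] with q hq hFq
  have h2 : (h.gram (F p) (F q) (coordDeriv E E' F p q (coordAt p q (Y q)))).comp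
      (coordDeriv E E' F p q) = g.gram p q (coordAt p q (projH E' g F q (Y q))) := by
    ext w
    have h3 : coordDeriv E E' F p q w
        = coordAt (F p) (F q) (mfderiv 𝓘(ℝ, E) 𝓘(ℝ, E') F q (coordSymm p q w)) := rfl
    rw [ContinuousLinearMap.comp_apply, ← coordAt_mfderiv hq, h3, ← h.inner_eq_gram hFq,
      hF.inner_mfderiv, g.inner_eq_gram hq, coordAt_coordSymm hq]
  rw [h2]
  obtain ⟨e, he⟩ := g.exists_gram_eq_equiv hq
  rw [← he, ContinuousLinearMap.inverse_equiv]
  exact (e.symm_apply_apply _).symm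

omit hF [FiniteDimensional ℝ E] [IsManifold 𝓘(ℝ, E') ∞ N] in
theorem _root_.SemiRiem.SmoothFieldAt.sub {Y Z : Π q : M, TangentSpace 𝓘(ℝ, E) q} {p : M}
    (hY : SmoothFieldAt Y p) (hZ : SmoothFieldAt Z p) : SmoothFieldAt (fun q ↦ Y q - Z q) p := by
  rw [smoothFieldAt_iff] at *
  simp only [map_sub]
  exact hY.sub hZ

/-- The vertical part of a smooth vector field is smooth. -/
theorem smoothFieldAt_projV {Y : Π q : M, TangentSpace 𝓘(ℝ, E) q} {p : M}
    (hY : SmoothFieldAt Y p) : SmoothFieldAt (fun q ↦ projV E' g F q (Y q)) p := by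
  have h1 := hY.sub (hF.smoothFieldAt_projH hY)
  simpa only [projH_apply, sub_sub_cancel] using h1

omit hF [IsManifold 𝓘(ℝ, E') ∞ N] in
/-- For a horizontal field `X` and a vertical field `Z`, the scalar product `g(X, Z)` is constant,
so that `∇` is skew on the pair. -/
theorem _root_.SemiRiem.inner_nabla_add_of_horizontal_of_vertical
    {X Z : Π q : M, TangentSpace 𝓘(ℝ, E) q} {p : M}
    (hX : SmoothFieldAt X p) (hZ : SmoothFieldAt Z p)
    (hXh : ∀ q, X q ∈ horizontal E' g F q) (hZv : ∀ q, Z q ∈ vertical E E' F q)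
    (u : TangentSpace 𝓘(ℝ, E) p) :
    g.inner p (g.nabla p u X) (Z p) + g.inner p (X p) (g.nabla p u Z) = 0 := by
  have h0 : (fun q ↦ g.inner q (X q) (Z q)) = fun _ ↦ 0 := funext fun q ↦ hXh q _ (hZv q)
  rw [← g.mvfderiv_inner hX hZ u, h0, mvfderiv_const]
  rfl

/-- For vertical `u` and `w`, O'Neill's tensor is `T_u w = H ∇_u W` for any vertical
extension `W` of `w`. -/
theorem oneillT_eq {p : M} {u w : TangentSpace 𝓘(ℝ, E) p}
    (hu : u ∈ vertical E E' F p) (hw : w ∈ vertical E E' F p) :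
    oneillT E' g F p u w = projH E' g F p
      (g.nabla p u fun q ↦ projV E' g F q ((FiberBundle.extend E w :
        Π q : M, TangentSpace 𝓘(ℝ, E) q) q)) := by
  unfold oneillT oneillTField
  rw [hF.projV_of_mem hu]
  -- The horizontal part of the extension vanishes at `p`, because w is vertical. Its derivative is
  -- thus orthogonal to every vertical vector, and the second summand of O'Neill's tensor drops out.
  have h0 : g.nabla p u (fun q ↦ projH E' g F q ((FiberBundle.extend E w :
      Π q : M, TangentSpace 𝓘(ℝ, E) q) q)) ∈ horizontal E' g F p := by
    intro z hz
    have h1 := inner_nabla_add_of_horizontal_of_vertical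
      (hF.smoothFieldAt_projH (smoothFieldAt_extend p w))
      (hF.smoothFieldAt_projV (smoothFieldAt_extend p z)) (fun q ↦ hF.projH_mem q _)
      (fun q ↦ hF.projV_mem q _) u
    simp only [FiberBundle.extend_apply_self] at h1
    rwa [hF.projV_of_mem hz, hF.projH_of_mem_vertical hw, map_zero, zero_apply, add_zero] at h1
  rw [hF.projV_of_mem_horizontal h0, add_zero]

variable [FiniteDimensional ℝ E']

omit [FiniteDimensional ℝ E] in
-- F_* Z vanishes identically, so its pullback derivative does too and only -F_*(∇_u Z) is left in
-- the second fundamental form.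
theorem mfderiv_nabla_of_vertical {Z : Π q : M, TangentSpace 𝓘(ℝ, E) q} {p : M}
    (hZ : SmoothFieldAt Z p) (hZv : ∀ q, Z q ∈ vertical E E' F q) (u : TangentSpace 𝓘(ℝ, E) p) :
    mfderiv 𝓘(ℝ, E) 𝓘(ℝ, E') F p (g.nabla p u Z) = -secondForm g h F p u (Z p) := by
  rw [← secondFormField_eq_secondForm g h hF.contMDiff u hZ]
  have h0 : (fun q ↦ mfderiv 𝓘(ℝ, E) 𝓘(ℝ, E') F q (Z q)) = fun _ ↦ 0 :=
    funext fun q ↦ mem_vertical.1 (hZv q)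
  have h1 : h.christoffel (F p) (mfderiv 𝓘(ℝ, E) 𝓘(ℝ, E') F p u) 0 = 0 := by
    have := h.christoffel_smul_right (F p) (mfderiv 𝓘(ℝ, E) 𝓘(ℝ, E') F p u) 0 0
    rwa [zero_smul, zero_smul] at this
  unfold secondFormField pullbackNabla
  rw [h0]
  simp only [map_zero]
  rw [h1, mvfderiv_const, zero_apply, map_zero, add_zero, zero_sub, neg_neg]

/-- T_u w is horizontal for vertical u and w, hence determined by its image under F_*. The symmetry
of T on vertical vectors is thereby that of the second fundamental form. -/
theorem mfderiv_oneillT {p : M} {u w : TangentSpace 𝓘(ℝ, E) p}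
    (hu : u ∈ vertical E E' F p) (hw : w ∈ vertical E E' F p) :
    mfderiv 𝓘(ℝ, E) 𝓘(ℝ, E') F p (oneillT E' g F p u w) = -secondForm g h F p u w := by
  rw [hF.oneillT_eq hu hw, hF.mfderiv_projH, hF.mfderiv_nabla_of_vertical
    (hF.smoothFieldAt_projV (smoothFieldAt_extend p w)) (fun q ↦ hF.projV_mem q _),
    FiberBundle.extend_apply_self, hF.projV_of_mem hw]

/-- Differentiate h(F_* Y, F_* Z) = g(Y, Z) along u for horizontal extensions. Both connections are
metric, so the terms in ∇_u Y and ∇_u Z cancel. -/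
theorem inner_secondForm_add {p : M} (u : TangentSpace 𝓘(ℝ, E) p) {y z : TangentSpace 𝓘(ℝ, E) p}
    (hy : y ∈ horizontal E' g F p) (hz : z ∈ horizontal E' g F p) :
    h.inner (F p) (secondForm g h F p u y) (mfderiv 𝓘(ℝ, E) 𝓘(ℝ, E') F p z)
      + h.inner (F p) (mfderiv 𝓘(ℝ, E) 𝓘(ℝ, E') F p y) (secondForm g h F p u z) = 0 := by
  set Y : Π q : M, TangentSpace 𝓘(ℝ, E) q := fun q ↦ projH E' g F q
    ((FiberBundle.extend E y : Π q : M, TangentSpace 𝓘(ℝ, E) q) q) with hYdef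
  set Z : Π q : M, TangentSpace 𝓘(ℝ, E) q := fun q ↦ projH E' g F q
    ((FiberBundle.extend E z : Π q : M, TangentSpace 𝓘(ℝ, E) q) q) with hZdef
  have hY : SmoothFieldAt Y p := hF.smoothFieldAt_projH (smoothFieldAt_extend p y)
  have hZ : SmoothFieldAt Z p := hF.smoothFieldAt_projH (smoothFieldAt_extend p z)
  have hYp : Y p = y := by
    rw [hYdef]
    simp only [FiberBundle.extend_apply_self]
    exact hF.projH_of_mem hy
  have hZp : Z p = z := by
    rw [hZdef]
    simp only [FiberBundle.extend_apply_self]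
    exact hF.projH_of_mem hz
  have hd : ∀ X : Π q : M, TangentSpace 𝓘(ℝ, E) q, SmoothFieldAt X p →
      MDifferentiableAt 𝓘(ℝ, E) 𝓘(ℝ, E')
        (fun q ↦ coordAt (F p) (F q) (mfderiv 𝓘(ℝ, E) 𝓘(ℝ, E') F q (X q))) p := fun X hX ↦ by
    have h1 := ((contMDiffAt_coordDeriv (hF.contMDiff.contMDiffAt (x := p))).clm_apply
      (smoothFieldAt_iff.1 hX)).mdifferentiableAt (by simp)
    refine h1.congr_of_eventuallyEq ?_
    filter_upwards [eventually_mem_source (E := E) p] with q hq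
    exact coordAt_mfderiv hq _
  have hpb : ∀ X : Π q : M, TangentSpace 𝓘(ℝ, E) q, SmoothFieldAt X p →
      pullbackNabla h F p u (fun q ↦ mfderiv 𝓘(ℝ, E) 𝓘(ℝ, E') F q (X q))
        = secondForm g h F p u (X p) + mfderiv 𝓘(ℝ, E) 𝓘(ℝ, E') F p (g.nabla p u X) :=
    fun X hX ↦ by
      rw [← secondFormField_eq_secondForm g h hF.contMDiff u hX, secondFormField, sub_add_cancel]
  have hD := h.mvfderiv_inner_pullback ((hF.contMDiff p).mdifferentiableAt (by simp))
    (hd Y hY) (hd Z hZ) u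
  have heq : (fun q ↦ h.inner (F q) (mfderiv 𝓘(ℝ, E) 𝓘(ℝ, E') F q (Y q))
      (mfderiv 𝓘(ℝ, E) 𝓘(ℝ, E') F q (Z q))) = fun q ↦ g.inner q (Y q) (Z q) :=
    funext fun q ↦ hF.inner_mfderiv_of_mem (hF.projH_mem q _) _
  rw [heq, g.mvfderiv_inner hY hZ, hpb Y hY, hpb Z hZ, hYp, hZp, map_add, map_add, add_apply,
    hF.inner_mfderiv_of_mem hy, h.symm _ (mfderiv 𝓘(ℝ, E) 𝓘(ℝ, E') F p (g.nabla p u Y)),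
    hF.inner_mfderiv_of_mem hz, g.symm p z] at hD
  linear_combination -hD

/-- The second fundamental form of a semi-Riemannian submersion vanishes on horizontal vectors. -/
theorem secondForm_eq_zero {p : M} {x y : TangentSpace 𝓘(ℝ, E) p}
    (hx : x ∈ horizontal E' g F p) (hy : y ∈ horizontal E' g F p) :
    secondForm g h F p x y = 0 := by
  have key : ∀ a ∈ horizontal E' g F p, ∀ b ∈ horizontal E' g F p, ∀ c ∈ horizontal E' g F p,
      h.inner (F p) (secondForm g h F p a b) (mfderiv 𝓘(ℝ, E) 𝓘(ℝ, E') F p c)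
        = -h.inner (F p) (secondForm g h F p a c) (mfderiv 𝓘(ℝ, E) 𝓘(ℝ, E') F p b) :=
    fun a _ b hb c hc ↦ by
      have h1 := hF.inner_secondForm_add a hb hc
      rw [h.symm _ (mfderiv 𝓘(ℝ, E) 𝓘(ℝ, E') F p b)] at h1
      linear_combination h1
  have hs := secondForm_symm g h hF.contMDiff (p := p)
  refine h.nondegenerate (F p) _ fun w ↦ ?_
  obtain ⟨z', rfl⟩ := hF.submersion p w
  rw [← hF.mfderiv_projH]
  set z := projH E' g F p z'
  have hz : z ∈ horizontal E' g F p := hF.projH_mem p z'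
  -- A trilinear form symmetric in the first two slots and skew in the last two is zero: going once
  -- around the three slots returns its own negative.
  have h1 := key x hx y hy z hz
  have h2 := key z hz x hx y hy
  have h3 := key y hy z hz x hx
  rw [hs z x] at h2
  rw [hs y z, hs y x] at h3
  linarith

end IsSemiRiemannianSubmersion

end Submersion

/-! ### Orthonormal bases and traces for indefinite bilinear forms -/

section OrthonormalBases

variable {T W ι κ : Type*} [AddCommGroup T] [Module ℝ T] [AddCommGroup W] [Module ℝ W]

/-- The family `e` is orthonormal for `B`: `B(e_i, e_i) = ± 1` and `B(e_i, e_j) = 0` for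
`i ≠ j`. -/
def BilinOrthonormal (B : LinearMap.BilinForm ℝ T) (e : ι → T) : Prop :=
  (∀ i, B (e i) (e i) = 1 ∨ B (e i) (e i) = -1) ∧ ∀ i j, i ≠ j → B (e i) (e j) = 0

variable {B : LinearMap.BilinForm ℝ T}

theorem BilinOrthonormal.mul_self {e : ι → T} (he : BilinOrthonormal B e) (i : ι) :
    B (e i) (e i) * B (e i) (e i) = 1 := by
  rcases he.1 i with h | h <;> rw [h] <;> norm_num

theorem BilinOrthonormal.sum_smul_eq [Fintype ι] {e : Basis ι ℝ T} (he : BilinOrthonormal B e)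
    (x : T) : ∑ i, (B (e i) (e i) * B x (e i)) • e i = x := by
  have h1 : ∀ i, B x (e i) = e.repr x i * B (e i) (e i) := fun i ↦ by
    conv_lhs => rw [← e.sum_repr x]
    rw [map_sum, LinearMap.sum_apply, Finset.sum_eq_single i]
    · rw [map_smul, LinearMap.smul_apply, smul_eq_mul]
    · intro j _ hj
      rw [map_smul, LinearMap.smul_apply, he.2 j i hj, smul_zero]
    · exact fun hi ↦ absurd (Finset.mem_univ i) hi
  conv_rhs => rw [← e.sum_repr x]
  refine Finset.sum_congr rfl fun i _ ↦ ?_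
  rw [h1, mul_left_comm, he.mul_self, mul_one]

/-- The trace of a bilinear map with respect to a scalar product does not depend on the
orthonormal basis. -/
theorem BilinOrthonormal.sum_apply_eq [Fintype ι] [Fintype κ] (hB : B.IsSymm) {e : Basis ι ℝ T}
    (he : BilinOrthonormal B e) {f : Basis κ ℝ T} (hf : BilinOrthonormal B f)
    (C : T →ₗ[ℝ] T →ₗ[ℝ] W) :
    ∑ i, B (e i) (e i) • C (e i) (e i) = ∑ j, B (f j) (f j) • C (f j) (f j) := by
  -- Expanding one argument e_i in the basis `f`, and below one argument f_j in the basis `e`, gives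
  -- the same double sum in the two orders.
  have h1 : ∀ i, B (e i) (e i) • C (e i) (e i) = ∑ j, (B (e i) (e i) *
      (B (f j) (f j) * B (e i) (f j))) • C (e i) (f j) := fun i ↦ by
    conv_lhs => enter [2, 2]; rw [← hf.sum_smul_eq (e i)]
    rw [map_sum, Finset.smul_sum]
    exact Finset.sum_congr rfl fun j _ ↦ by rw [map_smul, smul_smul]
  have h2 : ∀ j, B (f j) (f j) • C (f j) (f j) = ∑ i, (B (e i) (e i) *
      (B (f j) (f j) * B (e i) (f j))) • C (e i) (f j) := fun j ↦ by
    conv_lhs => enter [2, 1, 2]; rw [← he.sum_smul_eq (f j)]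
    rw [map_sum, LinearMap.sum_apply, Finset.smul_sum]
    refine Finset.sum_congr rfl fun i _ ↦ ?_
    rw [map_smul, LinearMap.smul_apply, smul_smul, hB.eq (f j) (e i)]
    congr 1
    ring
  simp_rw [h1, h2]
  exact Finset.sum_comm

/-- Take an orthogonal basis, whose vectors are non-null by nondegeneracy, and divide each by
√|B(v_i, v_i)|. -/
theorem exists_bilinOrthonormal_basis [FiniteDimensional ℝ T] (hB : B.IsSymm)
    (hB' : B.SeparatingLeft) :
    ∃ e : Basis (Fin (finrank ℝ T)) ℝ T, BilinOrthonormal B e := by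
  obtain ⟨v, hv⟩ := LinearMap.BilinForm.exists_orthogonal_basis
    (LinearMap.BilinForm.isSymm_iff.1 hB)
  have hne : ∀ i, B (v i) (v i) ≠ 0 := hv.not_isOrtho_basis_self_of_separatingLeft hB'
  have hs : ∀ i, 0 < √|B (v i) (v i)| := fun i ↦ Real.sqrt_pos.2 (abs_pos.2 (hne i))
  refine ⟨v.isUnitSMul (w := fun i ↦ (√|B (v i) (v i)|)⁻¹)
    fun i ↦ (inv_ne_zero (hs i).ne').isUnit, fun i ↦ ?_, fun i j hij ↦ ?_⟩
  · rw [Basis.isUnitSMul_apply, map_smul, map_smul, LinearMap.smul_apply, smul_eq_mul, smul_eq_mul,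
      ← mul_assoc, ← mul_inv, Real.mul_self_sqrt (abs_nonneg _)]
    rcases lt_or_gt_of_ne (hne i) with h | h
    · right
      rw [abs_of_neg h, inv_neg, neg_mul, inv_mul_cancel₀ h.ne]
    · left
      rw [abs_of_pos h, inv_mul_cancel₀ h.ne']
  · rw [Basis.isUnitSMul_apply, Basis.isUnitSMul_apply, map_smul, map_smul, LinearMap.smul_apply,
      show B (v i) (v j) = 0 from hv hij, smul_zero, smul_zero]

/-- Orthonormal bases of two complementary orthogonal subspaces form an orthonormal basis. -/
theorem exists_bilinOrthonormal_sum {V H : Submodule ℝ T} (hVH : IsCompl V H) (hB : B.IsSymm)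
    (h0 : ∀ v ∈ V, ∀ w ∈ H, B v w = 0) {e : Basis ι ℝ V} {f : Basis κ ℝ H}
    (he : BilinOrthonormal B fun i ↦ (e i : T)) (hf : BilinOrthonormal B fun j ↦ (f j : T)) :
    ∃ b : Basis (ι ⊕ κ) ℝ T, (∀ i, b (.inl i) = e i) ∧ (∀ j, b (.inr j) = f j) ∧
      BilinOrthonormal B b := by
  let b := (e.prod f).map (Submodule.prodEquivOfIsCompl V H hVH)
  have hl : ∀ i, b (.inl i) = e i := fun i ↦ by
    simp [b, Basis.prod_apply]
  have hr : ∀ j, b (.inr j) = f j := fun j ↦ by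
    simp [b, Basis.prod_apply]
  refine ⟨b, hl, hr, ?_, ?_⟩
  · rintro (i | j)
    · rw [hl]
      exact he.1 i
    · rw [hr]
      exact hf.1 j
  · rintro (i | i) (j | j) hij
    · rw [hl, hl]
      exact he.2 i j fun h ↦ hij (h ▸ rfl)
    · rw [hl, hr, h0 _ (e i).2 _ (f j).2]
    · rw [hl, hr, hB.eq, h0 _ (e j).2 _ (f i).2]
    · rw [hr, hr]
      exact hf.2 i j fun h ↦ hij (h ▸ rfl)

end OrthonormalBases

/-! ### Lorentzian almost contact and paracontact structures -/

namespace LorentzianAlmostContact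

section Algebra

variable {E M : Type*} [NormedAddCommGroup E] [NormedSpace ℝ E]
  [TopologicalSpace M] [ChartedSpace E M] [IsManifold 𝓘(ℝ, E) ∞ M]
  {ε : ℝ} {g : Metric E M} (S : LorentzianAlmostContact ε g)

theorem xi_ne_zero (hε : ε * ε = 1) (p : M) : S.xi p ≠ 0 := fun h0 ↦ by
  have h1 := S.eta_xi p
  rw [h0, map_zero] at h1
  nlinarith

theorem phi_phi_xi (p : M) : S.phi p (S.phi p (S.xi p)) = 0 := by
  rw [S.phi_phi, S.eta_xi, ← add_smul, add_neg_cancel, zero_smul]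

theorem eta_phi (hε : ε * ε = 1) (p : M) (v : TangentSpace 𝓘(ℝ, E) p) :
    S.eta p (S.phi p v) = 0 := by
  -- Computing φ³w as φ²(φw) and as φ(φ²w) and comparing.
  have key : ∀ w, S.eta p (S.phi p w) • S.xi p = S.eta p w • S.phi p (S.xi p) := fun w ↦ by
    have h1 := S.phi_phi p (S.phi p w)
    rw [S.phi_phi p w, map_add, map_smul, map_smul] at h1
    exact (add_left_cancel h1).symm
  -- At w = ξ the comparison reads η(φξ) ξ = -ε φξ; applying φ gives η(φξ) φξ = 0, and either factor
  -- being zero forces φξ = 0.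
  have hxi : S.phi p (S.xi p) = 0 := by
    have h1 := key (S.xi p)
    rw [S.eta_xi] at h1
    have h2 := congrArg (S.phi p) h1
    rw [map_smul, map_smul, S.phi_phi_xi, smul_zero] at h2
    rcases smul_eq_zero.1 h2 with h3 | h3
    · rw [h3, zero_smul] at h1
      rcases smul_eq_zero.1 h1.symm with h4 | h4
      · nlinarith
      · exact h4
    · exact h3
  have h1 := key v
  rw [hxi, smul_zero] at h1
  exact (smul_eq_zero.1 h1).resolve_right (S.xi_ne_zero hε p)

theorem phi_xi (hε : ε * ε = 1) (p : M) : S.phi p (S.xi p) = 0 := by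
  have h1 := S.phi_phi p (S.phi p (S.xi p))
  rw [S.phi_phi_xi, map_zero, S.eta_phi hε, zero_smul, add_zero] at h1
  exact (smul_eq_zero.1 h1.symm).resolve_left fun h0 ↦ by rw [h0] at hε; norm_num at hε

/-- Put φw for w in the compatibility of φ with g and expand φ²w; the terms with η disappear because
η ∘ φ = 0, that is, φv ⊥ ξ. -/
theorem inner_phi_left (hε : ε * ε = 1) (p : M) (v w : TangentSpace 𝓘(ℝ, E) p) :
    g.inner p (S.phi p v) w = ε * g.inner p v (S.phi p w) := by
  have h1 := S.inner_phi_phi p v (S.phi p w)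
  rw [S.eta_phi hε, mul_zero, add_zero, S.phi_phi, map_add, map_smul, map_smul, smul_eq_mul,
    smul_eq_mul] at h1
  have h2 := S.eta_eq p (S.phi p v)
  rw [S.eta_phi hε] at h2
  have h3 : g.inner p (S.phi p v) (S.xi p) = 0 := by
    linear_combination -ε * h2 - g.inner p (S.phi p v) (S.xi p) * hε
  rw [h3, mul_zero, add_zero] at h1
  linear_combination ε * h1 - g.inner p (S.phi p v) w * hε

theorem inner_xi_xi (hε : ε * ε = 1) (p : M) : g.inner p (S.xi p) (S.xi p) = -1 := by
  have h1 := S.eta_eq p (S.xi p)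
  rw [S.eta_xi] at h1
  linear_combination -ε * h1 - (1 + g.inner p (S.xi p) (S.xi p)) * hε

end Algebra

section Submersion

variable {E E' M N : Type*} [NormedAddCommGroup E] [NormedSpace ℝ E] [FiniteDimensional ℝ E]
  [NormedAddCommGroup E'] [NormedSpace ℝ E'] [FiniteDimensional ℝ E']
  [TopologicalSpace M] [ChartedSpace E M] [IsManifold 𝓘(ℝ, E) ∞ M]
  [TopologicalSpace N] [ChartedSpace E' N] [IsManifold 𝓘(ℝ, E') ∞ N]
  {ε : ℝ} {g : Metric E M} (S : LorentzianAlmostContact ε g)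
  {h : Metric E' N} {F : M → N} (hF : IsSemiRiemannianSubmersion g h F)
  (hanti : S.IsAntiInvariant (E' := E') F)

include hF in
omit [FiniteDimensional ℝ E'] in
theorem _root_.SemiRiem.IsSemiRiemannianSubmersion.finrank_vertical (p : M) :
    finrank ℝ E' + finrank ℝ (vertical E E' F p) = finrank ℝ E := by
  have := finiteDimensional_tangentSpace (E := E) p
  have h1 := LinearMap.finrank_range_add_finrank_ker (mfderiv 𝓘(ℝ, E) 𝓘(ℝ, E') F p).toLinearMap
  rw [LinearMap.range_eq_top.2 (hF.submersion p), finrank_top] at h1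
  exact h1

include hF hanti in
omit [FiniteDimensional ℝ E'] in
/-- If `dim M = 2 dim N + 1`, then `ξ` is vertical and `φ` maps the vertical space onto the
horizontal one. -/
theorem xi_mem_vertical_and_surjective (hε : ε * ε = 1)
    (hdim : finrank ℝ E = 2 * finrank ℝ E' + 1) (p : M) :
    S.xi p ∈ vertical E E' F p ∧
      ∀ x ∈ horizontal E' g F p, ∃ v ∈ vertical E E' F p, S.phi p v = x := by
  have := finiteDimensional_tangentSpace (E := E) p
  have hε0 : ε ≠ 0 := fun h0 ↦ by rw [h0] at hε; norm_num at hε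
  have hV := hF.finrank_vertical p
  have hVH : finrank ℝ (vertical E E' F p) + finrank ℝ (horizontal E' g F p) = finrank ℝ E :=
    Submodule.finrank_add_eq_of_isCompl (hF.isCompl p)
  let f : vertical E E' F p →ₗ[ℝ] horizontal E' g F p :=
    (S.phi p).toLinearMap.restrict (hanti p)
  have hf : ∀ v, (f v : TangentSpace 𝓘(ℝ, E) p) = S.phi p v := fun v ↦ rfl
  have hker : ∀ v ∈ LinearMap.ker f, ε • (v : TangentSpace 𝓘(ℝ, E) p) + S.eta p v • S.xi p = 0 :=
    fun v hv ↦ by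
      rw [← S.phi_phi, ← hf, LinearMap.mem_ker.1 hv, ZeroMemClass.coe_zero, map_zero]
  have heta : ∀ v ∈ LinearMap.ker f, S.eta p v = 0 → v = 0 := fun v hv h0 ↦ by
    have h1 := hker v hv
    rw [h0, zero_smul, add_zero] at h1
    exact Subtype.ext ((smul_eq_zero.1 h1).resolve_left hε0)
  -- On the kernel, εv = -η(v) ξ, so η is injective there.
  have hle : finrank ℝ (LinearMap.ker f) ≤ 1 := by
    let η : LinearMap.ker f →ₗ[ℝ] ℝ := (S.eta p).toLinearMap ∘ₗ
      (vertical E E' F p).subtype ∘ₗ (LinearMap.ker f).subtype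
    have hη : Function.Injective η := (injective_iff_map_eq_zero η).2 fun v hv ↦
      Subtype.ext (heta v v.2 hv)
    simpa using LinearMap.finrank_le_finrank_of_injective hη
  have hrn := LinearMap.finrank_range_add_finrank_ker f
  have hrle := Submodule.finrank_le (LinearMap.range f)
  -- Rank and nullity add up to n + 1, with rank at most n and nullity at most 1, so both bounds are
  -- attained. The one-dimensional kernel then provides a vertical multiple of ξ.
  have hrange : LinearMap.range f = ⊤ := Submodule.eq_top_of_finrank_eq (by omega)
  constructor
  · have hpos : 0 < finrank ℝ (LinearMap.ker f) := by omega
    obtain ⟨v, hv0⟩ := (finrank_pos_iff_exists_ne_zero (R := ℝ)).1 hpos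
    have h1 := hker v v.2
    have h2 : S.eta p (v : vertical E E' F p) ≠ 0 := fun h0 ↦
      hv0 (Subtype.ext (heta v v.2 h0))
    have h3 : S.xi p = (S.eta p (v : vertical E E' F p))⁻¹ •
        (-ε) • ((v : vertical E E' F p) : TangentSpace 𝓘(ℝ, E) p) := by
      rw [neg_smul, ← eq_neg_of_add_eq_zero_right h1, inv_smul_smul₀ h2]
    rw [h3]
    exact Submodule.smul_mem _ _ (Submodule.smul_mem _ _ (v : vertical E E' F p).2)
  · intro x hx
    obtain ⟨v, hv⟩ := LinearMap.range_eq_top.1 hrange ⟨x, hx⟩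
    exact ⟨v, v.2, by rw [← hf, hv]⟩

include hF hanti in
-- The Sasakian identity paired with a vertical vector. Tracing it over u = z gives the formula for
-- tr(φ T_V).
theorem inner_phi_oneillT (hε : ε * ε = 1) (hS : S.IsSasakian) {p : M}
    {u v z : TangentSpace 𝓘(ℝ, E) p} (hu : u ∈ vertical E E' F p) (hv : v ∈ vertical E E' F p)
    (hz : z ∈ vertical E E' F p) :
    g.inner p (S.phi p (oneillT E' g F p v u)) z
      = h.inner (F p) (mfderiv 𝓘(ℝ, E) 𝓘(ℝ, E') F p (S.phi p v)) (secondForm g h F p u z)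
        - g.inner p (S.phi p u) (S.phi p v) * g.inner p (S.xi p) z
        - ε * S.eta p v * g.inner p (S.phi p (S.phi p u)) z := by
  set Y : Π q : M, TangentSpace 𝓘(ℝ, E) q := fun q ↦ projV E' g F q
    ((FiberBundle.extend E v : Π q : M, TangentSpace 𝓘(ℝ, E) q) q) with hYdef
  set Z : Π q : M, TangentSpace 𝓘(ℝ, E) q := fun q ↦ projV E' g F q
    ((FiberBundle.extend E z : Π q : M, TangentSpace 𝓘(ℝ, E) q) q) with hZdef
  have hY : SmoothFieldAt Y p := hF.smoothFieldAt_projV (smoothFieldAt_extend p v)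
  have hZ : SmoothFieldAt Z p := hF.smoothFieldAt_projV (smoothFieldAt_extend p z)
  have hYv : ∀ q, Y q ∈ vertical E E' F q := fun q ↦ hF.projV_mem q _
  have hZv : ∀ q, Z q ∈ vertical E E' F q := fun q ↦ hF.projV_mem q _
  have hYp : Y p = v := by
    rw [hYdef]
    simp only [FiberBundle.extend_apply_self]
    exact hF.projV_of_mem hv
  have hZp : Z p = z := by
    rw [hZdef]
    simp only [FiberBundle.extend_apply_self]
    exact hF.projV_of_mem hz
  have hφY : SmoothFieldAt (fun q ↦ S.phi q (Y q)) p :=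
    (S.phi_contMDiff.contMDiffAt (x := p)).clm_bundle_apply hY
  have hφz : S.phi p z ∈ horizontal E' g F p := hanti p z hz
  have h1 : g.inner p (S.phi p (oneillT E' g F p v u)) z = -(ε * h.inner (F p)
      (mfderiv 𝓘(ℝ, E) 𝓘(ℝ, E') F p (S.phi p z)) (secondForm g h F p u v)) := by
    rw [S.inner_phi_left hε, g.symm, ← hF.inner_mfderiv_of_mem hφz, hF.mfderiv_oneillT hv hu,
      secondForm_symm g h hF.contMDiff v u, map_neg, mul_neg]
  -- Same value as for T_v u: φz is horizontal, so only the horizontal part of ∇_u Y counts, and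
  -- that is T_u v = T_v u.
  have h2 : g.inner p (S.phi p (g.nabla p u Y)) z = -(ε * h.inner (F p)
      (mfderiv 𝓘(ℝ, E) 𝓘(ℝ, E') F p (S.phi p z)) (secondForm g h F p u v)) := by
    rw [S.inner_phi_left hε, g.symm, ← hF.inner_mfderiv_of_mem hφz,
      hF.mfderiv_nabla_of_vertical hY hYv, hYp, map_neg, mul_neg]
  -- φY is horizontal by anti-invariance and Z is vertical, so the derivative moves from φY to Z
  -- with a sign.
  have h3 : g.inner p (g.nabla p u fun q ↦ S.phi q (Y q)) z
      = h.inner (F p) (mfderiv 𝓘(ℝ, E) 𝓘(ℝ, E') F p (S.phi p v)) (secondForm g h F p u z) := by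
    have h4 := inner_nabla_add_of_horizontal_of_vertical hφY hZ (fun q ↦ hanti q _ (hYv q)) hZv u
    rw [hYp, hZp, ← hF.inner_mfderiv_of_mem (hanti p v hv),
      hF.mfderiv_nabla_of_vertical hZ hZv, hZp, map_neg] at h4
    linear_combination h4
  have h5 := congrArg (fun x ↦ g.inner p x z) (hS p u Y hY)
  simp only [map_sub, map_add, map_smul, sub_apply, add_apply, smul_apply, smul_eq_mul, hYp,
    h2, h3] at h5
  rw [h1]
  linear_combination -h5

end Submersion

end LorentzianAlmostContact

/-! ### The trace formula and the tension field -/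

section Main

variable {E E' M N : Type*} [NormedAddCommGroup E] [NormedSpace ℝ E] [FiniteDimensional ℝ E]
  [NormedAddCommGroup E'] [NormedSpace ℝ E'] [FiniteDimensional ℝ E']
  [TopologicalSpace M] [ChartedSpace E M] [IsManifold 𝓘(ℝ, E) ∞ M]
  [TopologicalSpace N] [ChartedSpace E' N] [IsManifold 𝓘(ℝ, E') ∞ N]

/-- For a vertical orthonormal basis `e`, `tr(φ T_v) = h(F_* φ v, ∑ ε_i (∇F_*)(e_i, e_i)) - n η(v)`
where `n + 1` is the dimension of the fibres. -/
theorem LorentzianAlmostContact.sum_inner_phi_oneillT {ε : ℝ}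
    {g : Metric E M} (S : LorentzianAlmostContact ε g) {h : Metric E' N} {F : M → N}
    (hF : IsSemiRiemannianSubmersion g h F) (hanti : S.IsAntiInvariant (E' := E') F)
    (hε : ε * ε = 1) (hS : S.IsSasakian) {p : M} (hxi : S.xi p ∈ vertical E E' F p)
    {v : TangentSpace 𝓘(ℝ, E) p} (hv : v ∈ vertical E E' F p) {ι : Type*} [Fintype ι]
    (e : Basis ι ℝ (vertical E E' F p))
    (he : g.IsOrthonormal p fun i ↦ (e i : TangentSpace 𝓘(ℝ, E) p)) :
    ∑ i, g.inner p (e i) (e i) * g.inner p (S.phi p (oneillT E' g F p v (e i))) (e i)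
      = h.inner (F p) (mfderiv 𝓘(ℝ, E) 𝓘(ℝ, E') F p (S.phi p v))
          (∑ i, g.inner p (e i) (e i) • secondForm g h F p (e i) (e i))
        - (Fintype.card ι - 1) * S.eta p v := by
  have he' : BilinOrthonormal ((g.bilin p).restrict (vertical E E' F p)) e := he
  have hsq : ∀ i, g.inner p (e i : TangentSpace 𝓘(ℝ, E) p) (e i)
      * g.inner p (e i : TangentSpace 𝓘(ℝ, E) p) (e i) = 1 := he'.mul_self
  -- Here verticality of ξ is needed: it expands in the vertical basis alone. Applying g(φv, φ ·)
  -- and g(ξ, ·) to this expansion evaluates the two remaining sums, by φξ = 0 and g(ξ, ξ) = -1.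
  have hx : ∑ i, (g.inner p (e i : TangentSpace 𝓘(ℝ, E) p) (e i) * g.inner p (S.xi p) (e i))
      • (e i : TangentSpace 𝓘(ℝ, E) p) = S.xi p := by
    have h1 := congrArg (vertical E E' F p).subtype (he'.sum_smul_eq ⟨S.xi p, hxi⟩)
    rw [map_sum] at h1
    exact h1
  have hsum1 : ∑ i, g.inner p (e i : TangentSpace 𝓘(ℝ, E) p) (e i)
      * (g.inner p (S.phi p (e i)) (S.phi p v) * g.inner p (S.xi p) (e i)) = 0 := by
    have h1 := congrArg (fun x ↦ g.inner p (S.phi p v) (S.phi p x)) hx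
    simp only [map_sum, map_smul, S.phi_xi hε, map_zero, smul_eq_mul] at h1
    rw [← h1]
    refine Finset.sum_congr rfl fun i _ ↦ ?_
    rw [g.symm p (S.phi p v)]
    ring
  have hsum2 : ∑ i, g.inner p (e i : TangentSpace 𝓘(ℝ, E) p) (e i)
      * (g.inner p (S.xi p) (e i) * g.inner p (S.xi p) (e i)) = -1 := by
    have h1 := congrArg (fun x ↦ g.inner p (S.xi p) x) hx
    simp only [map_sum, map_smul, S.inner_xi_xi hε, smul_eq_mul] at h1
    rw [← h1]
    exact Finset.sum_congr rfl fun i _ ↦ by ring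
  have hterm : ∀ i, g.inner p (e i : TangentSpace 𝓘(ℝ, E) p) (e i)
      * g.inner p (S.phi p (oneillT E' g F p v (e i))) (e i)
      = h.inner (F p) (mfderiv 𝓘(ℝ, E) 𝓘(ℝ, E') F p (S.phi p v))
          (g.inner p (e i : TangentSpace 𝓘(ℝ, E) p) (e i) • secondForm g h F p (e i) (e i))
        - g.inner p (e i : TangentSpace 𝓘(ℝ, E) p) (e i)
          * (g.inner p (S.phi p (e i)) (S.phi p v) * g.inner p (S.xi p) (e i))
        - S.eta p v * (1 + g.inner p (e i : TangentSpace 𝓘(ℝ, E) p) (e i)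
          * (g.inner p (S.xi p) (e i) * g.inner p (S.xi p) (e i))) := fun i ↦ by
    rw [S.inner_phi_oneillT hF hanti hε hS (e i).2 hv (e i).2, S.phi_phi, S.eta_eq p (e i),
      map_add, map_smul, map_smul, map_smul, add_apply, smul_apply, smul_apply,
      smul_eq_mul, smul_eq_mul, smul_eq_mul, g.symm p (e i) (S.xi p)]
    linear_combination (-ε * ε * S.eta p v) * hsq i - S.eta p v * (1
      + g.inner p (e i : TangentSpace 𝓘(ℝ, E) p) (e i)
        * (g.inner p (S.xi p) (e i) * g.inner p (S.xi p) (e i))) * hε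
  rw [Finset.sum_congr rfl fun i _ ↦ hterm i, Finset.sum_sub_distrib, Finset.sum_sub_distrib,
    hsum1, ← map_sum, ← Finset.mul_sum, Finset.sum_add_distrib, hsum2, Finset.sum_const,
    Finset.card_univ, nsmul_eq_mul]
  ring

/-- The tension field of a semi-Riemannian submersion is the trace of the second fundamental form
over the vertical space. -/
theorem IsSemiRiemannianSubmersion.sum_secondForm_eq {g : Metric E M} {h : Metric E' N} {F : M → N}
    (hF : IsSemiRiemannianSubmersion g h F) {p : M} {ι κ : Type*} [Fintype ι] [Fintype κ]
    (b : Basis ι ℝ (TangentSpace 𝓘(ℝ, E) p)) (hb : g.IsOrthonormal p b)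
    (e : Basis κ ℝ (vertical E E' F p))
    (he : g.IsOrthonormal p fun i ↦ (e i : TangentSpace 𝓘(ℝ, E) p)) :
    ∑ i, g.inner p (b i) (b i) • secondForm g h F p (b i) (b i)
      = ∑ i, g.inner p (e i) (e i) • secondForm g h F p (e i) (e i) := by
  have := finiteDimensional_tangentSpace (E := E) p
  -- A horizontal vector orthogonal to all horizontal vectors is orthogonal to everything, so the
  -- horizontal space has an orthonormal basis.
  have hsl : ((g.bilin p).restrict (horizontal E' g F p)).SeparatingLeft := fun x hx ↦
    Subtype.ext (g.nondegenerate p x fun w ↦ by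
      have h1 := hx ⟨projH E' g F p w, hF.projH_mem p w⟩
      have h2 : g.inner p (x : TangentSpace 𝓘(ℝ, E) p) (projH E' g F p w) = 0 := h1
      rwa [projH_apply, map_sub, x.2 _ (hF.projV_mem p w), sub_zero] at h2)
  obtain ⟨f, hf⟩ := exists_bilinOrthonormal_basis ((g.bilin_isSymm p).restrict _) hsl
  obtain ⟨c, hcl, hcr, hc⟩ := exists_bilinOrthonormal_sum (hF.isCompl p) (g.bilin_isSymm p)
    (fun v hv w hw ↦ by rw [g.bilin_apply, g.symm]; exact hw v hv) (e := e) (f := f) he hf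
  have hb' : BilinOrthonormal (g.bilin p) b := hb
  have key := hb'.sum_apply_eq (g.bilin_isSymm p) hc (secondFormBilin g h hF.contMDiff p)
  rw [Fintype.sum_sum_type] at key
  simp only [hcl, hcr] at key
  have h0 : ∀ j, secondFormBilin g h hF.contMDiff p (f j) (f j) = 0 := fun j ↦
    hF.secondForm_eq_zero (f j).2 (f j).2
  simp only [h0, smul_zero, Finset.sum_const_zero, add_zero] at key
  exact key

end Main

end SemiRiem

theorem mainTheorem11
    {E E' M N : Type*} [NormedAddCommGroup E] [NormedSpace ℝ E] [FiniteDimensional ℝ E]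
    [NormedAddCommGroup E'] [NormedSpace ℝ E'] [FiniteDimensional ℝ E']
    [TopologicalSpace M] [ChartedSpace E M] [IsManifold 𝓘(ℝ, E) ∞ M]
    [TopologicalSpace N] [ChartedSpace E' N] [IsManifold 𝓘(ℝ, E') ∞ N]
    (m n : ℕ) (hmn : m = n)
    (hM : Module.finrank ℝ E = 2 * m + 1) (hN : Module.finrank ℝ E' = n)
    (ε : ℝ) (hε : ε = -1 ∨ ε = 1)
    (g : SemiRiem.Metric E M) (S : SemiRiem.LorentzianAlmostContact ε g) (hS : S.IsSasakian)
    (h : SemiRiem.Metric E' N) (hh : h.IsRiemannian)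
    (F : M → N) (hF : SemiRiem.IsSemiRiemannianSubmersion g h F)
    (hanti : S.IsAntiInvariant (E' := E') F) :
    SemiRiem.IsHarmonic g h F ↔
      ∀ (p : M), ∀ V ∈ SemiRiem.vertical E E' F p,
        g.HasTraceOn p (SemiRiem.vertical E E' F p)
          (fun W ↦ S.phi p (SemiRiem.oneillT E' g F p V W)) (-(n : ℝ) * S.eta p V) := by
  have hε' : ε * ε = 1 := by rcases hε with rfl | rfl <;> norm_num
  have hdim : finrank ℝ E = 2 * finrank ℝ E' + 1 := by rw [hM, hN, hmn]
  have hcard : ∀ p : M, (Fintype.card (Fin (finrank ℝ (SemiRiem.vertical E E' F p))) : ℝ) - 1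
      = n := fun p ↦ by
    have h1 := hF.finrank_vertical p
    have h2 : finrank ℝ (SemiRiem.vertical E E' F p) = n + 1 := by omega
    rw [Fintype.card_fin, h2]
    push_cast
    ring
  constructor
  · intro hharm p V hV e he
    have := SemiRiem.finiteDimensional_tangentSpace (E := E) p
    -- Harmonicity quantifies over orthonormal bases, so one must exist for it to say anything; the
    -- converse needs a vertical one likewise.
    obtain ⟨b, hb⟩ : ∃ b : Basis (Fin (finrank ℝ E)) ℝ (TangentSpace 𝓘(ℝ, E) p),
        g.IsOrthonormal p b := SemiRiem.exists_bilinOrthonormal_basis (g.bilin_isSymm p)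
      fun x hx ↦ g.nondegenerate p x hx
    have h0 := hharm p b hb
    rw [hF.sum_secondForm_eq b hb e he] at h0
    rw [S.sum_inner_phi_oneillT hF hanti hε' hS
      (S.xi_mem_vertical_and_surjective hF hanti hε' hdim p).1 hV e he, h0, map_zero, hcard]
    ring
  · intro htr p b hb
    have := SemiRiem.finiteDimensional_tangentSpace (E := E) p
    obtain ⟨hxi, hsurj⟩ := S.xi_mem_vertical_and_surjective hF hanti hε' hdim p
    obtain ⟨e, he⟩ := SemiRiem.exists_bilinOrthonormal_basis
      ((g.bilin_isSymm p).restrict (SemiRiem.vertical E E' F p)) fun x hx ↦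
        Subtype.ext (hF.nondegenerate_fiber p x x.2 fun w hw ↦ hx ⟨w, hw⟩)
    rw [hF.sum_secondForm_eq b hb e he]
    refine h.nondegenerate (F p) _ fun w ↦ ?_
    obtain ⟨x, rfl⟩ := hF.submersion p w
    rw [← hF.mfderiv_projH]
    -- Every vector of TN is F_* φV for some vertical V, so the trace condition tests τ against all
    -- of TN.
    obtain ⟨V, hV, hVx⟩ := hsurj _ (hF.projH_mem p x)
    have h1 := htr p V hV e he
    rw [S.sum_inner_phi_oneillT hF hanti hε' hS hxi hV e he, hcard, hVx] at h1
    rw [h.symm]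
    linear_combination h1
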